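/- Let $\Bbbk$ be a field, $A=\Bbbk[x_1,\dots,x_n]$ with its standard grading, $\mathfrak m_A=(x_1,\dots,x_n)$, $\mathfrak a\subseteq A$ a homogeneous ideal, $R=A/\mathfrak a$, and $\mathfrak m_R=\mathfrak m_AR$. Let $t$ be a positive integer or $\infty$, $B=A[z]$ and $S=R[z]/(z^t)=B/(\mathfrak aB+(z^t))$, where $z^\infty=0$. An ideal $J$ of $S$ is \emph{$z$-stable} if it is multigraded (homogeneous for $\deg x_l=(1,0)$, $\deg z=(0,1)$) and $\mathfrak m_R\,J_{\langle i\rangle}\subseteq J_{\langle i-1\rangle}$ for all integers $0<i<t$, where $J_{\langle i\rangle}=(J:_Sz^i)\cap R$. Graded resolutions and twists are taken with respect to the standard grading of $B$ (in which $\deg z=1$); graded free modules in resolutions have finite rank; and $\beta_{i,q}(M)=\dim_\Bbbk\operatorname{Tor}_i^B(M,\Bbbk)_q$, with $\beta_{-1,q}=0$. Let $J$ be a $z$-stable ideal of $S$. Replace $J$ by its preimage in $B$ (so that $S/J$ becomes $B/J$), and put $J_{\langle i\rangle}=(J:_Bz^i)\cap A$ for $i<t$ and $J_{\langle i\rangle}=J_{\langle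 t-1\rangle}$ for $i\ge t$. Let $J'=\bigoplus_{i\ge0}J_{\langle i\rangle}z^i$, an ideal of $B$. Then $J'$ has a finite minimal system of multigraded generators, ordered as $f_1z^{j_1},\dots,f_mz^{j_m}$ with $j_1\le\dots\le j_m$ and each $f_l\in A$ homogeneous, say of degree $d_l$. For every such system, put $K_s=(f_1z^{j_1},\dots,f_sz^{j_s})$ and let $m_0$ be the number of $l$ with $j_l=0$. Then: (1) $K_{m_0}=J_{\langle0\rangle}B$; the $A$-module $A/J_{\langle0\rangle}$ has a minimal graded free resolution, and for each such resolution $P_\bullet$, $P_\bullet\otimes_AB$ is a minimal graded $B$-free resolution of $B/K_{m_0}$. (2) For every $l$ with $j_l>0$, $(K_{l-1}:_Bf_lz^{j_l})=\mathfrak m_AB$ and there is a graded exact sequence $$0\to (B/\mathfrak m_AB)(-d_l-j_l)\xrightarrow{f_lz^{j_l}}B/K_{l-1}\to B/K_l\to0.$$ Minimal graded $B$-free resolutions of the first two modules exist, comparison maps between any two such resolutions exist, and the mapping cone of every (degree-zero) comparison map is a minimal graded $B$-free resolution of $B/K_l$. Moreover $\beta_{i,q}(B/K_l)=\beta_{i,q}(B/K_{l-1})+\beta_{i-1,q}\big((B/\mathfrak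 m_AB)(-d_l-j_l)\big)$ for all $i\ge0$ and $q\in\mathbb Z$. (3) $K_m=J'$. If $t=\infty$, then $J'=J$. (4) If $t$ is finite, then $J=J'+(z^t)$, $(J':_Bz^t)=J_{\langle t-1\rangle}B$, and there is a graded exact sequence $$0\to (B/J_{\langle t-1\rangle}B)(-t)\xrightarrow{z^t}B/J'\to S/J\to0.$$ Again minimal graded $B$-free resolutions of the first two modules and comparison maps between them exist, the mapping cone of every comparison map between minimal graded $B$-free resolutions is a minimal graded $B$-free resolution of $S/J$, and $\beta_{i,q}(S/J)=\beta_{i,q}(B/J')+\beta_{i-1,q}\big((B/J_{\langle t-1\rangle}B)(-t)\big)$ for all $i\ge0$ and $q\in\mathbb Z$. (5) Consequently, a minimal graded $B$-free resolution of $S/J$ is obtained as an iterated mapping cone: start with $P_\bullet\otimes_AB$ as in (1); for $l=m_0+1,\dots,m$ pass to a mapping cone as in (2), using the complex already constructed as the resolution of $B/K_{l-1}$; if $t$ is finite, finish with a mapping cone as in (4). Such an iteration exists; and for all choices made in it, every complex that occurs is a minimal graded free resolution, of $B/K_l$ at stage $l$ and of $S/J$ at the end. -/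

import Mathlib

namespace ZStable

/-! ### Finite graded free complexes, resolutions, mapping cones -/

section Complexes

universe u

/-- A complex `⋯ → F₂ → F₁ → F₀` of graded free modules of finite rank over a commutative ring `B`
with grading `𝓑`.  The module `F i` is `⨁ a : ι i, B(-deg i a)`, and `d i : F (i+1) → F i` is given
by a matrix which is homogeneous of degree zero. -/
structure GradedFreeComplex {B : Type u} [CommRing B] (𝓑 : ℤ → AddSubgroup B) where
  ι : ℕ → Type
  [fintype : ∀ i, Fintype (ι i)]
  deg : ∀ i, ι i → ℤ
  d : ∀ i, Matrix (ι i) (ι (i + 1)) B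
  homogeneous : ∀ i a b, d i a b ∈ 𝓑 (deg (i + 1) b - deg i a)
  d_comp_d : ∀ i, d i * d (i + 1) = 0

attribute [instance] GradedFreeComplex.fintype

variable {B : Type u} [CommRing B] {𝓑 : ℤ → AddSubgroup B}

/-- A chain map of graded free complexes, homogeneous of degree zero. -/
structure GradedFreeComplex.Hom (F G : GradedFreeComplex 𝓑) where
  mat : ∀ i, Matrix (G.ι i) (F.ι i) B
  homogeneous : ∀ i a b, mat i a b ∈ 𝓑 (F.deg i b - G.deg i a)
  comm : ∀ i, G.d i * mat (i + 1) = mat i * F.d i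

/-- Index types of the mapping cone: `C₀ = G₀` and `C_{i+1} = G_{i+1} ⊕ F_i`. -/
def coneIndex (F G : GradedFreeComplex 𝓑) : ℕ → Type
  | 0 => G.ι 0
  | i + 1 => G.ι (i + 1) ⊕ F.ι i

instance coneIndexFintype (F G : GradedFreeComplex 𝓑) : ∀ i, Fintype (coneIndex F G i)
  | 0 => G.fintype 0
  | i + 1 => inferInstanceAs (Fintype (G.ι (i + 1) ⊕ F.ι i))

def coneDeg (F G : GradedFreeComplex 𝓑) : ∀ i, coneIndex F G i → ℤ
  | 0 => G.deg 0
  | i + 1 => Sum.elim (G.deg (i + 1)) (F.deg i)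

/-- The differential `(y, x) ↦ (d y + Φ x, - d x)` of the mapping cone. -/
def coneD {F G : GradedFreeComplex 𝓑} (Φ : F.Hom G) :
    ∀ i, Matrix (coneIndex F G i) (coneIndex F G (i + 1)) B
  | 0 => Matrix.fromCols (G.d 0) (Φ.mat 0)
  | i + 1 => Matrix.fromBlocks (G.d (i + 1)) (Φ.mat (i + 1)) 0 (-F.d i)

theorem coneD_homogeneous {F G : GradedFreeComplex 𝓑} (Φ : F.Hom G) :
    ∀ i a b, coneD Φ i a b ∈ 𝓑 (coneDeg F G (i + 1) b - coneDeg F G i a)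
  | 0, a, Sum.inl b => G.homogeneous 0 a b
  | 0, a, Sum.inr b => Φ.homogeneous 0 a b
  | i + 1, Sum.inl a, Sum.inl b => G.homogeneous (i + 1) a b
  | i + 1, Sum.inl a, Sum.inr b => Φ.homogeneous (i + 1) a b
  | _ + 1, Sum.inr _, Sum.inl _ => AddSubgroup.zero_mem _
  | i + 1, Sum.inr a, Sum.inr b => AddSubgroup.neg_mem _ (F.homogeneous i a b)

theorem coneD_comp {F G : GradedFreeComplex 𝓑} (Φ : F.Hom G) :
    ∀ i, coneD Φ i * coneD Φ (i + 1) = 0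
  | 0 => by
    change Matrix.fromCols (G.d 0) (Φ.mat 0) *
      Matrix.fromBlocks (G.d 1) (Φ.mat 1) 0 (-F.d 0) = 0
    rw [Matrix.fromCols_mul_fromBlocks, G.d_comp_d 0, Φ.comm 0]
    simp
  | i + 1 => by
    change Matrix.fromBlocks (G.d (i + 1)) (Φ.mat (i + 1)) 0 (-F.d i) *
      Matrix.fromBlocks (G.d (i + 2)) (Φ.mat (i + 2)) 0 (-F.d (i + 1)) = 0
    rw [Matrix.fromBlocks_multiply, G.d_comp_d (i + 1), Φ.comm (i + 1)]
    simp [F.d_comp_d i]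

/-- The mapping cone of a chain map of graded free complexes. -/
def cone {F G : GradedFreeComplex 𝓑} (Φ : F.Hom G) : GradedFreeComplex 𝓑 where
  ι := coneIndex F G
  deg := coneDeg F G
  d := coneD Φ
  homogeneous := coneD_homogeneous Φ
  d_comp_d := coneD_comp Φ

/-- The base change `F ⊗_A B` along a degree-preserving ring homomorphism `A → B`. -/
def GradedFreeComplex.baseChange {A : Type u} [CommRing A] {𝓐 : ℤ → AddSubgroup A}
    (F : GradedFreeComplex 𝓐) (f : A →+* B) (hf : ∀ q, ∀ a ∈ 𝓐 q, f a ∈ 𝓑 q) :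
    GradedFreeComplex 𝓑 where
  ι := F.ι
  deg := F.deg
  d i := (F.d i).map f
  homogeneous i a b := hf _ _ (F.homogeneous i a b)
  d_comp_d i := by rw [← Matrix.map_mul, F.d_comp_d i]; simp

/-- `F`, together with the map `F₀ → M` sending the basis vector `a` to `ε a`, is a graded free
resolution of the graded `B`-module `M = ⨁ ℳ q`. -/
structure IsGradedFreeResolution {M : Type u} [AddCommGroup M] [Module B M]
    (ℳ : ℤ → AddSubgroup M) (F : GradedFreeComplex 𝓑) (ε : F.ι 0 → M) : Prop where
  augmentation_degree : ∀ a, ε a ∈ ℳ (F.deg 0 a)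
  augmentation_surjective : ∀ x : M, ∃ v : F.ι 0 → B, ∑ a, v a • ε a = x
  augmentation_comp : ∀ b, ∑ a, F.d 0 a b • ε a = 0
  exact_zero : ∀ v : F.ι 0 → B, ∑ a, v a • ε a = 0 → ∃ w, (F.d 0).mulVec w = v
  exact_succ : ∀ i, ∀ v : F.ι (i + 1) → B, (F.d i).mulVec v = 0 →
    ∃ w, (F.d (i + 1)).mulVec w = v

/-- A minimal graded free resolution: all entries of the differentials lie in the irrelevant
maximal ideal, the kernel of the residue map `res : B → 𝕜`. -/
structure IsMinimalGradedFreeResolution {𝕜 : Type u} [Field 𝕜] (res : B →+* 𝕜)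
    {M : Type u} [AddCommGroup M] [Module B M]
    (ℳ : ℤ → AddSubgroup M) (F : GradedFreeComplex 𝓑) (ε : F.ι 0 → M) : Prop
    extends IsGradedFreeResolution ℳ F ε where
  minimal : ∀ i a b, res (F.d i a b) = 0

/-- `Φ` is a comparison map lifting `φ : M → N` to the complexes `F`, `G` augmented to `M`, `N`. -/
def IsComparison {M N : Type u} [AddCommGroup M] [Module B M] [AddCommGroup N] [Module B N]
    (φ : M →ₗ[B] N) {F G : GradedFreeComplex 𝓑} (εF : F.ι 0 → M) (εG : G.ι 0 → N)
    (Φ : F.Hom G) : Prop :=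
  ∀ b, ∑ a, Φ.mat 0 a b • εG a = φ (εF b)

/-- The degree `q` part of the differential `F_{i+1} ⊗ 𝕜 → F_i ⊗ 𝕜`. -/
def GradedFreeComplex.resMap (F : GradedFreeComplex 𝓑) {𝕜 : Type u} [Field 𝕜] (res : B →+* 𝕜)
    (i : ℕ) (q : ℤ) :
    ({b : F.ι (i + 1) // F.deg (i + 1) b = q} → 𝕜) →ₗ[𝕜] ({a : F.ι i // F.deg i a = q} → 𝕜) :=
  (((F.d i).map res).submatrix Subtype.val Subtype.val).mulVecLin

/-- `dim_𝕜 H_i(F ⊗_B 𝕜)_q`.  When `F` is a graded free resolution of `M`, this is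
`dim_𝕜 Tor_i^B(M, 𝕜)_q`, the graded Betti number `β_{i,q}^B(M)`. -/
noncomputable def GradedFreeComplex.torDim (F : GradedFreeComplex 𝓑) {𝕜 : Type u} [Field 𝕜]
    (res : B →+* 𝕜) : ℕ → ℤ → ℕ
  | 0, q => Module.finrank 𝕜
      (({a : F.ι 0 // F.deg 0 a = q} → 𝕜) ⧸ LinearMap.range (F.resMap res 0 q))
  | i + 1, q => Module.finrank 𝕜
      (LinearMap.ker (F.resMap res i q) ⧸
        (LinearMap.range (F.resMap res (i + 1) q)).submoduleOf (LinearMap.ker (F.resMap res i q)))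

/-- `0 → M → N → Q → 0` is a short exact sequence of graded modules and degree zero maps. -/
structure IsGradedShortExact {M N Q : Type u} [AddCommGroup M] [Module B M] [AddCommGroup N]
    [Module B N] [AddCommGroup Q] [Module B Q] (ℳ : ℤ → AddSubgroup M) (𝒩 : ℤ → AddSubgroup N)
    (𝒬 : ℤ → AddSubgroup Q) (φ : M →ₗ[B] N) (ψ : N →ₗ[B] Q) : Prop where
  degree_left : ∀ q, ∀ x ∈ ℳ q, φ x ∈ 𝒩 q
  degree_right : ∀ q, ∀ x ∈ 𝒩 q, ψ x ∈ 𝒬 q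
  injective : Function.Injective φ
  exact : Function.Exact φ ψ
  surjective : Function.Surjective ψ

/-- `0 → M → N → Q → 0` is graded exact; minimal graded free resolutions of `M` and `N` exist;
the graded Betti numbers satisfy `β_{i,q}(Q) = β_{i,q}(N) + β_{i-1,q}(M)`; and for all minimal
graded free resolutions `F` of `M` and `G` of `N`, comparison maps `F → G` exist and the mapping
cone of each of them is a minimal graded free resolution of `Q`. -/
structure IsMinimalConeStep {𝕜 : Type u} [Field 𝕜] (𝓑 : ℤ → AddSubgroup B) (res : B →+* 𝕜)
    {M N Q : Type u} [AddCommGroup M] [Module B M] [AddCommGroup N]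
    [Module B N] [AddCommGroup Q] [Module B Q] (ℳ : ℤ → AddSubgroup M) (𝒩 : ℤ → AddSubgroup N)
    (𝒬 : ℤ → AddSubgroup Q) (φ : M →ₗ[B] N) (ψ : N →ₗ[B] Q) : Prop where
  shortExact : IsGradedShortExact ℳ 𝒩 𝒬 φ ψ
  exists_left : ∃ (F : GradedFreeComplex 𝓑) (ε : F.ι 0 → M),
    IsMinimalGradedFreeResolution res ℳ F ε
  exists_middle : ∃ (G : GradedFreeComplex 𝓑) (ε : G.ι 0 → N),
    IsMinimalGradedFreeResolution res 𝒩 G ε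
  betti_add : ∀ (F G H : GradedFreeComplex 𝓑) (εF : F.ι 0 → M) (εG : G.ι 0 → N)
    (εH : H.ι 0 → Q), IsGradedFreeResolution ℳ F εF → IsGradedFreeResolution 𝒩 G εG →
    IsGradedFreeResolution 𝒬 H εH → ∀ q : ℤ, H.torDim res 0 q = G.torDim res 0 q ∧
      ∀ i : ℕ, H.torDim res (i + 1) q = G.torDim res (i + 1) q + F.torDim res i q
  exists_comparison : ∀ (F G : GradedFreeComplex 𝓑) (εF : F.ι 0 → M) (εG : G.ι 0 → N),
    IsMinimalGradedFreeResolution res ℳ F εF → IsMinimalGradedFreeResolution res 𝒩 G εG →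
    ∃ Φ : F.Hom G, IsComparison φ εF εG Φ
  cone_minimal : ∀ (F G : GradedFreeComplex 𝓑) (εF : F.ι 0 → M) (εG : G.ι 0 → N),
    IsMinimalGradedFreeResolution res ℳ F εF → IsMinimalGradedFreeResolution res 𝒩 G εG →
    ∀ Φ : F.Hom G, IsComparison φ εF εG Φ →
      IsMinimalGradedFreeResolution res 𝒬 (cone Φ) (fun a : G.ι 0 => ψ (εG a))

/-- For a quotient ring `Q` of `B`, the grading of the graded cyclic module `Q(-e)`. -/
def cyclicGrading (𝓑 : ℤ → AddSubgroup B) (Q : Type u) [CommRing Q] [Algebra B Q] (e : ℤ) :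
    ℤ → AddSubgroup Q :=
  fun q => (𝓑 (q - e)).map (algebraMap B Q).toAddMonoidHom

end Complexes

/-! ### The rings `A = 𝕜[x₁, …, xₙ]`, `B = A[z]`, `R = A/𝔞`, `S = R[z]/(z^t)` -/

section Rings

universe u

open Polynomial (C X)

variable (𝕜 : Type u) [Field 𝕜] (n : ℕ)

abbrev PolyA : Type u := MvPolynomial (Fin n) 𝕜

/-- `B = A[z]`; the variable `z` is `Polynomial.X`. -/
abbrev PolyB : Type u := Polynomial (PolyA 𝕜 n)

/-- The standard grading of `A`. -/
def gradingA (q : ℤ) : AddSubgroup (PolyA 𝕜 n) where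
  carrier := {p | ∀ m, p.coeff m ≠ 0 → (m.degree : ℤ) = q}
  zero_mem' := by simp
  add_mem' {p r} hp hr m h := by
    by_cases h1 : p.coeff m = 0
    · exact hr m (by simpa [h1] using h)
    · exact hp m h1
  neg_mem' {p} hp m h := hp m (by simpa using h)

/-- The standard grading of `B`, in which `z` also has degree one. -/
def gradingB (q : ℤ) : AddSubgroup (PolyB 𝕜 n) where
  carrier := {p | ∀ i : ℕ, p.coeff i ∈ gradingA 𝕜 n (q - i)}
  zero_mem' i := by simp
  add_mem' hp hr i := by simpa using AddSubgroup.add_mem _ (hp i) (hr i)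
  neg_mem' hp i := by simpa using hp i

theorem C_mem_gradingB (q : ℤ) (a : PolyA 𝕜 n) (ha : a ∈ gradingA 𝕜 n q) :
    (C a : PolyB 𝕜 n) ∈ gradingB 𝕜 n q := by
  intro i
  rcases Nat.eq_zero_or_pos i with rfl | hi
  · simpa using ha
  · rw [Polynomial.coeff_C_of_ne_zero hi.ne']
    exact AddSubgroup.zero_mem _

/-- The residue map `A → A/𝔪_A = 𝕜`. -/
noncomputable abbrev resA : PolyA 𝕜 n →+* 𝕜 := MvPolynomial.constantCoeff

/-- The residue map `B → B/𝔪_B = 𝕜`. -/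
noncomputable abbrev resB : PolyB 𝕜 n →+* 𝕜 :=
  (resA 𝕜 n).comp Polynomial.constantCoeff

/-- The homogeneous maximal ideal `𝔪_A = (x₁, …, xₙ)` of `A`. -/
noncomputable def maxA : Ideal (PolyA 𝕜 n) := Ideal.span (Set.range MvPolynomial.X)

variable {𝕜 n}

/-- Homogeneous ideals of `A`. -/
def IsHomogeneousIdeal (𝔞 : Ideal (PolyA 𝕜 n)) : Prop :=
  letI := MvPolynomial.gradedAlgebra (σ := Fin n) (R := 𝕜)
  𝔞.IsHomogeneous (MvPolynomial.homogeneousSubmodule (Fin n) 𝕜)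

/-- The ideal `(z^t)` of `B`, which is zero for `t = ∞`. -/
noncomputable def zPowIdeal (𝕜 : Type u) [Field 𝕜] (n : ℕ) (t : ℕ∞) : Ideal (PolyB 𝕜 n) :=
  Ideal.span {p | ∃ T : ℕ, t = T ∧ p = X ^ T}

/-- `S = R[z]/(z^t) = B/(𝔞B + (z^t))`. -/
def RingS (𝔞 : Ideal (PolyA 𝕜 n)) (t : ℕ∞) : Type u :=
  PolyB 𝕜 n ⧸ (𝔞.map (C : PolyA 𝕜 n →+* PolyB 𝕜 n) ⊔ zPowIdeal 𝕜 n t)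

noncomputable instance (𝔞 : Ideal (PolyA 𝕜 n)) (t : ℕ∞) : CommRing (RingS 𝔞 t) :=
  inferInstanceAs (CommRing (PolyB 𝕜 n ⧸ (𝔞.map C ⊔ zPowIdeal 𝕜 n t)))

noncomputable instance (𝔞 : Ideal (PolyA 𝕜 n)) (t : ℕ∞) : Algebra (PolyB 𝕜 n) (RingS 𝔞 t) :=
  inferInstanceAs (Algebra (PolyB 𝕜 n) (PolyB 𝕜 n ⧸ (𝔞.map C ⊔ zPowIdeal 𝕜 n t)))

/-- The projection `B → S`. -/
noncomputable abbrev toS (𝔞 : Ideal (PolyA 𝕜 n)) (t : ℕ∞) : PolyB 𝕜 n →+* RingS 𝔞 t :=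
  algebraMap _ _

/-- The natural map `R = A/𝔞 → S`. -/
noncomputable def fromR (𝔞 : Ideal (PolyA 𝕜 n)) (t : ℕ∞) : (PolyA 𝕜 n ⧸ 𝔞) →+* RingS 𝔞 t :=
  Ideal.quotientMap (𝔞.map C ⊔ zPowIdeal 𝕜 n t) C (Ideal.map_le_iff_le_comap.mp le_sup_left)

/-- For an ideal `J` of `S`, the ideal `J_⟨i⟩ = (J :_S z^i) ∩ R` of `R`. -/
noncomputable def compR {𝔞 : Ideal (PolyA 𝕜 n)} {t : ℕ∞} (J : Ideal (RingS 𝔞 t)) (i : ℕ) :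
    Ideal (PolyA 𝕜 n ⧸ 𝔞) :=
  (J.colon {toS 𝔞 t (X ^ i)}).comap (fromR 𝔞 t)

/-- `J` is multigraded, for `deg x_l = (1, 0)` and `deg z = (0, 1)`: it contains all bihomogeneous
components of its elements. -/
def IsMultigraded {𝔞 : Ideal (PolyA 𝕜 n)} {t : ℕ∞} (J : Ideal (RingS 𝔞 t)) : Prop :=
  ∀ p : PolyB 𝕜 n, toS 𝔞 t p ∈ J → ∀ d i : ℕ,
    toS 𝔞 t (C (MvPolynomial.homogeneousComponent d (p.coeff i)) * X ^ i) ∈ J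

/-- `J` is `z`-stable: it is multigraded and `𝔪_R J_⟨i⟩ ⊆ J_⟨i-1⟩` for all `0 < i < t`. -/
structure IsZStable {𝔞 : Ideal (PolyA 𝕜 n)} {t : ℕ∞} (J : Ideal (RingS 𝔞 t)) : Prop where
  multigraded : IsMultigraded J
  stable : ∀ i : ℕ, 0 < i → (i : ℕ∞) < t →
    (maxA 𝕜 n).map (Ideal.Quotient.mk 𝔞) * compR J i ≤ compR J (i - 1)

/-- The preimage of `J` in `B`. -/
noncomputable def preimage {𝔞 : Ideal (PolyA 𝕜 n)} {t : ℕ∞} (J : Ideal (RingS 𝔞 t)) :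
    Ideal (PolyB 𝕜 n) :=
  J.comap (toS 𝔞 t)

/-- For the preimage in `B` of `J`: the ideal `J_⟨i⟩ = (J :_B z^i) ∩ A` of `A` if `i < t`, and
`J_⟨i⟩ = J_⟨t-1⟩` if `i ≥ t`. -/
noncomputable def compA {𝔞 : Ideal (PolyA 𝕜 n)} {t : ℕ∞} (J : Ideal (RingS 𝔞 t)) (i : ℕ) :
    Ideal (PolyA 𝕜 n) :=
  ((preimage J).colon {X ^ (if (i : ℕ∞) < t then i else t.toNat - 1)}).comap C

theorem compA_le_succ {𝔞 : Ideal (PolyA 𝕜 n)} {t : ℕ∞} (J : Ideal (RingS 𝔞 t)) (i : ℕ) :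
    compA J i ≤ compA J (i + 1) := by
  intro a ha
  simp only [compA, Ideal.mem_comap, Submodule.mem_colon_singleton, smul_eq_mul] at ha ⊢
  have key : ∀ {k l : ℕ}, k ≤ l → C a * X ^ k ∈ preimage J → C a * X ^ l ∈ preimage J := by
    intro k l hkl h
    have h2 : (C a * X ^ l : PolyB 𝕜 n) = X ^ (l - k) * (C a * X ^ k) := by
      rw [mul_left_comm, ← pow_add, Nat.sub_add_cancel hkl]
    rw [h2]
    exact Ideal.mul_mem_left _ _ h
  refine key ?_ ha
  split_ifs with h1 h2 h2
  · omega
  · rw [not_lt] at h2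
    have ht : t ≠ ⊤ := fun h => by
      rw [h, top_le_iff] at h2
      exact ENat.natCast_ne_top _ h2
    lift t to ℕ using ht
    norm_cast at h1 h2
    simp only [ENat.toNat_natCast]
    omega
  · exact absurd ((by exact_mod_cast Nat.le_succ i : (i : ℕ∞) ≤ ((i + 1 : ℕ) : ℕ∞)).trans_lt h2) h1
  · exact le_rfl

/-- The ideal `J' = ⨁_{i ∈ ℕ} J_⟨i⟩ z^i` of `B`. -/
noncomputable def primeIdeal {𝔞 : Ideal (PolyA 𝕜 n)} {t : ℕ∞} (J : Ideal (RingS 𝔞 t)) :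
    Ideal (PolyB 𝕜 n) where
  carrier := {p | ∀ i, p.coeff i ∈ compA J i}
  zero_mem' i := by simp
  add_mem' hp hr i := by simpa using Ideal.add_mem _ (hp i) (hr i)
  smul_mem' c p hp i := by
    rw [smul_eq_mul, Polynomial.coeff_mul]
    refine Ideal.sum_mem _ fun x hx => Ideal.mul_mem_left _ _ ?_
    refine monotone_nat_of_le_succ (compA_le_succ J) ?_ (hp x.2)
    have := Finset.HasAntidiagonal.mem_antidiagonal.mp hx
    omega

/-- `F`, augmented by `ε`, is a minimal graded free `A`-resolution of `A/I`. -/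
def IsMinResA (I : Ideal (PolyA 𝕜 n)) (F : GradedFreeComplex (gradingA 𝕜 n))
    (ε : F.ι 0 → PolyA 𝕜 n ⧸ I) : Prop :=
  IsMinimalGradedFreeResolution (resA 𝕜 n) (cyclicGrading (gradingA 𝕜 n) (PolyA 𝕜 n ⧸ I) 0) F ε

/-- For a quotient ring `Q` of `B`: `F`, augmented by `ε`, is a minimal graded free `B`-resolution
of the graded module `Q(-e)`. -/
def IsMinResB (Q : Type u) [CommRing Q] [Algebra (PolyB 𝕜 n) Q] (e : ℤ)
    (F : GradedFreeComplex (gradingB 𝕜 n)) (ε : F.ι 0 → Q) : Prop :=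
  IsMinimalGradedFreeResolution (resB 𝕜 n) (cyclicGrading (gradingB 𝕜 n) Q e) F ε

/-- For quotient rings `M`, `N`, `Q` of `B`: multiplication by `g` and the projection give maps of
a minimal cone step `0 → M(-e) → N → Q → 0` over `B`. -/
def IsConeStepB (M N Q : Type u) [CommRing M] [Algebra (PolyB 𝕜 n) M] [CommRing N]
    [Algebra (PolyB 𝕜 n) N] [CommRing Q] [Algebra (PolyB 𝕜 n) Q] (e : ℤ) (g : PolyB 𝕜 n) : Prop :=
  ∃ (φ : M →ₗ[PolyB 𝕜 n] N) (ψ : N →ₐ[PolyB 𝕜 n] Q), φ 1 = algebraMap (PolyB 𝕜 n) N g ∧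
    IsMinimalConeStep (gradingB 𝕜 n) (resB 𝕜 n) (cyclicGrading (gradingB 𝕜 n) M e)
      (cyclicGrading (gradingB 𝕜 n) N 0) (cyclicGrading (gradingB 𝕜 n) Q 0) φ ψ.toLinearMap

/-- For quotient rings `M`, `N` of `B`: `Φ` is a comparison map lifting multiplication by `g`,
as a `B`-linear map `M → N`. -/
def IsComparisonB {M N : Type u} [CommRing M] [Algebra (PolyB 𝕜 n) M] [CommRing N]
    [Algebra (PolyB 𝕜 n) N] (g : PolyB 𝕜 n) {F G : GradedFreeComplex (gradingB 𝕜 n)}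
    (εF : F.ι 0 → M) (εG : G.ι 0 → N) (Φ : F.Hom G) : Prop :=
  ∃ φ : M →ₗ[PolyB 𝕜 n] N, φ 1 = algebraMap (PolyB 𝕜 n) N g ∧ IsComparison φ εF εG Φ

end Rings

/-! ### Generators and the iterated mapping cone -/

section Iterated

universe u

open Polynomial (C X)

variable {𝕜 : Type u} [Field 𝕜] {n : ℕ}

/-- The ideal generated by the first `s` of the elements `f₀ z^{j₀}, f₁ z^{j₁}, …`. -/
noncomputable def partialIdeal {m : ℕ} (f : Fin m → PolyA 𝕜 n) (j : Fin m → ℕ) (s : ℕ) :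
    Ideal (PolyB 𝕜 n) :=
  Ideal.span {p | ∃ l : Fin m, (l : ℕ) < s ∧ p = C (f l) * X ^ j l}

theorem partialIdeal_le_succ {m : ℕ} (f : Fin m → PolyA 𝕜 n) (j : Fin m → ℕ) (s : ℕ) :
    partialIdeal f j s ≤ partialIdeal f j (s + 1) :=
  Ideal.span_mono fun _ ⟨l, hl, h⟩ => ⟨l, hl.trans (Nat.lt_succ_self s), h⟩

/-- `f₀ z^{j₀}, …, f_{m-1} z^{j_{m-1}}` is a minimal system of multigraded generators of the ideal
`I`, where `f_l` is homogeneous of degree `d_l`, ordered such that `j₀ ≤ j₁ ≤ ⋯`. -/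
structure IsOrderedMinGens (I : Ideal (PolyB 𝕜 n)) {m : ℕ} (f : Fin m → PolyA 𝕜 n)
    (d j : Fin m → ℕ) : Prop where
  homogeneous : ∀ l, (f l).IsHomogeneous (d l)
  ordered : Monotone j
  span_eq : Ideal.span (Set.range fun l => (C (f l) * X ^ j l : PolyB 𝕜 n)) = I
  irredundant : ∀ l, (C (f l) * X ^ j l : PolyB 𝕜 n) ∉
    Ideal.span ((fun l' => (C (f l') * X ^ j l' : PolyB 𝕜 n)) '' {l' | l' ≠ l})

/-- The number of generators of `z`-degree zero. -/
def numZero {m : ℕ} (j : Fin m → ℕ) : ℕ := (Finset.univ.filter fun l => j l = 0).card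

/-- `B/𝔪_A B`, to be used with the grading of `(B/𝔪_A B)(-d-j)`. -/
abbrev ModMaxA (𝕜 : Type u) [Field 𝕜] (n : ℕ) : Type u :=
  PolyB 𝕜 n ⧸ (maxA 𝕜 n).map (C : PolyA 𝕜 n →+* PolyB 𝕜 n)

/-- `ConeTower I₀ f d j s G ε`: the complex `G`, augmented to `B/(f₀ z^{j₀}, …, f_{s-1} z^{j_{s-1}})`
by `ε`, is obtained as follows.  Start with `P ⊗_A B`, for a minimal graded free `A`-resolution `P`
of `A/I₀`; for each further generator `f_l z^{j_l}` (those with `j_l > 0`) pass to the mapping cone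
of a comparison map, lifting multiplication by `f_l z^{j_l}`, from a minimal graded free
`B`-resolution of `(B/𝔪_A B)(-d_l-j_l)` to the complex constructed so far. -/
inductive ConeTower (I₀ : Ideal (PolyA 𝕜 n)) {m : ℕ} (f : Fin m → PolyA 𝕜 n) (d j : Fin m → ℕ) :
    (s : ℕ) → (G : GradedFreeComplex (gradingB 𝕜 n)) →
      (G.ι 0 → PolyB 𝕜 n ⧸ partialIdeal f j s) → Prop
  | base (P : GradedFreeComplex (gradingA 𝕜 n)) (ε : P.ι 0 → PolyA 𝕜 n ⧸ I₀)
      (hP : IsMinResA I₀ P ε)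
      (h : I₀ ≤ (partialIdeal f j (numZero j)).comap C) :
      ConeTower I₀ f d j (numZero j) (P.baseChange C (C_mem_gradingB 𝕜 n))
        (fun a : P.ι 0 => Ideal.quotientMap _ C h (ε a))
  | step (l : Fin m) (hl : 0 < j l) (G : GradedFreeComplex (gradingB 𝕜 n))
      (εG : G.ι 0 → PolyB 𝕜 n ⧸ partialIdeal f j l) (hG : ConeTower I₀ f d j l G εG)
      (F : GradedFreeComplex (gradingB 𝕜 n)) (εF : F.ι 0 → ModMaxA 𝕜 n)
      (hF : IsMinResB (ModMaxA 𝕜 n) (d l + j l) F εF)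
      (Φ : F.Hom G) (hΦ : IsComparisonB (C (f l) * X ^ j l) εF εG Φ) :
      ConeTower I₀ f d j (l + 1) (cone Φ)
        (fun a : G.ι 0 => Ideal.Quotient.factor (partialIdeal_le_succ f j l) (εG a))

/-- `IsIteratedCone J f d j H ε`: the complex `H`, augmented to `S/J` by `ε`, is the iterated mapping
cone of `ConeTower` over all generators `f_l z^{j_l}` of `J'`, followed, if `t` is finite, by the
mapping cone of a comparison map, lifting multiplication by `z^t`, from a minimal graded free
`B`-resolution of `(B/J_⟨t-1⟩B)(-t)`. -/
inductive IsIteratedCone {𝔞 : Ideal (PolyA 𝕜 n)} {t : ℕ∞} (J : Ideal (RingS 𝔞 t)) {m : ℕ}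
    (f : Fin m → PolyA 𝕜 n) (d j : Fin m → ℕ) :
    (H : GradedFreeComplex (gradingB 𝕜 n)) → (H.ι 0 → RingS 𝔞 t ⧸ J) → Prop
  | infinite (ht : t = ⊤) (G : GradedFreeComplex (gradingB 𝕜 n))
      (εG : G.ι 0 → PolyB 𝕜 n ⧸ partialIdeal f j m)
      (hG : ConeTower (compA J 0) f d j m G εG)
      (ψ : (PolyB 𝕜 n ⧸ partialIdeal f j m) →ₐ[PolyB 𝕜 n] RingS 𝔞 t ⧸ J) :
      IsIteratedCone J f d j G (fun a => ψ (εG a))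
  | finite (T : ℕ) (ht : t = T) (G : GradedFreeComplex (gradingB 𝕜 n))
      (εG : G.ι 0 → PolyB 𝕜 n ⧸ partialIdeal f j m)
      (hG : ConeTower (compA J 0) f d j m G εG)
      (ψ : (PolyB 𝕜 n ⧸ partialIdeal f j m) →ₐ[PolyB 𝕜 n] RingS 𝔞 t ⧸ J)
      (F : GradedFreeComplex (gradingB 𝕜 n))
      (εF : F.ι 0 → PolyB 𝕜 n ⧸ (compA J (T - 1)).map C)
      (hF : IsMinResB (PolyB 𝕜 n ⧸ (compA J (T - 1)).map C) T F εF)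
      (Φ : F.Hom G) (hΦ : IsComparisonB (X ^ T) εF εG Φ) :
      IsIteratedCone J f d j (cone Φ) (fun a : G.ι 0 => ψ (εG a))

end Iterated

end ZStable

open ZStable

/-! Every step adjoins one homogeneous element `g = z g'` to an ideal `K` of `B`. With `I = (K : g)`
there is an exact sequence `0 → (B/I)(-e) → B/K → B/(K + (g)) → 0`, and the mapping cone of any lift
of its left map to free resolutions resolves the right-hand module. If the two resolutions are
minimal, the cone is minimal as soon as the lift has all its entries in the irrelevant ideal.

This holds because `I g' ⊆ K`: multiplication by `g` is then `z` times a well-defined map `φ' : B/I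
→ B/K`, multiplication by `g'`, of degree one less. If `Ψ` lifts `φ'`, then `z Ψ` is a comparison
map with irrelevant entries. Any other comparison map differs from it by a homotopy term `d h + h
d`, whose entries are irrelevant since both differentials are minimal (`comparison_res_eq_zero`,
`isConeStepB_of_colon`). Counting ranks in the minimal cone gives the Betti numbers.

It remains to compute colon ideals. Membership in an ideal generated by elements `f_l z^{j_l}` is
tested on each coefficient of `z^i` (`mem_span_monomials`). By `z`-stability, `𝔪_A f_l` lies in
level `j_l - 1` of `J'`, which is generated by those `f_k` with `j_k < j_l`, all earlier in the
order. Hence `𝔪_A f_l z^{j_l - 1} ⊆ K_{l-1}`, which gives both `I g' ⊆ K` and one inclusion of the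
colon formula. Irredundancy of the generators gives the other, since a multiplier with nonzero
constant term would put `f_l z^{j_l}` into `K_{l-1}`. For `g = z^t` the levels of `J'` are constant
from `t - 1` on, so `(J' : z^t) = J_⟨t-1⟩B`, and `J_⟨t-1⟩ z^{t-1} ⊆ J'` by construction. -/

namespace ZStable

/-! ### Lifts, homotopies and mapping cones for graded free complexes given by matrices. -/

section Graded

universe u v w

/-- Projections onto the homogeneous components of a `ℤ`-graded commutative ring. -/
structure RingProj {B : Type u} [CommRing B] (𝓑 : ℤ → AddSubgroup B) where
  proj : ℤ → B →+ B
  one_mem : (1 : B) ∈ 𝓑 0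
  proj_mem : ∀ q x, proj q x ∈ 𝓑 q
  proj_of_mem : ∀ {q x}, x ∈ 𝓑 q → proj q x = x
  proj_mul : ∀ {p b}, b ∈ 𝓑 p → ∀ q x, proj q (x * b) = proj (q - p) x * b
  exists_sum : ∀ x, ∃ s : Finset ℤ, ∀ s', s ⊆ s' → ∑ q ∈ s', proj q x = x

/-- Projections onto the homogeneous components of a graded module. -/
structure ModProj {B : Type u} [CommRing B] {𝓑 : ℤ → AddSubgroup B} (P : RingProj 𝓑)
    {M : Type v} [AddCommGroup M] [Module B M] (ℳ : ℤ → AddSubgroup M) where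
  proj : ℤ → M →+ M
  proj_mem : ∀ q x, proj q x ∈ ℳ q
  proj_of_mem : ∀ {q x}, x ∈ ℳ q → proj q x = x
  proj_smul : ∀ {p m}, m ∈ ℳ p → ∀ q (b : B), proj q (b • m) = P.proj (q - p) b • m
  exists_sum : ∀ x, ∃ s : Finset ℤ, ∑ q ∈ s, proj q x = x

variable {B : Type u} [CommRing B] {𝓑 : ℤ → AddSubgroup B}

theorem RingProj.mul_mem (P : RingProj 𝓑) {p q r : ℤ} {x y : B} (hx : x ∈ 𝓑 p) (hy : y ∈ 𝓑 q)
    (h : p + q = r) : x * y ∈ 𝓑 r := by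
  have h1 := P.proj_mul hy r x
  rw [show r - q = p by omega, P.proj_of_mem hx] at h1
  exact h1 ▸ P.proj_mem r _

theorem ModProj.proj_sum {P : RingProj 𝓑} {M : Type v} [AddCommGroup M] [Module B M]
    {ℳ : ℤ → AddSubgroup M} (Q : ModProj P ℳ) {ι : Type w} [Fintype ι] {ε : ι → M} {deg : ι → ℤ}
    (hε : ∀ a, ε a ∈ ℳ (deg a)) (q : ℤ) (v : ι → B) :
    Q.proj q (∑ a, v a • ε a) = ∑ a, P.proj (q - deg a) (v a) • ε a := by
  rw [map_sum]
  exact Finset.sum_congr rfl fun a _ => Q.proj_smul (hε a) q (v a)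

/-- A matrix of a map of graded free modules which is homogeneous of degree `s`. -/
def IsHomMat (𝓑 : ℤ → AddSubgroup B) (s : ℤ) {ι κ : Type*} (degι : ι → ℤ) (degκ : κ → ℤ)
    (X : Matrix ι κ B) : Prop :=
  ∀ a b, X a b ∈ 𝓑 (degκ b + s - degι a)

theorem GradedFreeComplex.isHomMat_d (F : GradedFreeComplex 𝓑) (i : ℕ) :
    IsHomMat 𝓑 0 (F.deg i) (F.deg (i + 1)) (F.d i) := fun a b => by
  simpa using F.homogeneous i a b

section HomMat

variable {ι κ τ : Type*} {s s' r : ℤ} {degι : ι → ℤ} {degκ : κ → ℤ} {degτ : τ → ℤ}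

theorem IsHomMat.mul [Fintype κ] (P : RingProj 𝓑) {X : Matrix ι κ B} {Y : Matrix κ τ B}
    (hX : IsHomMat 𝓑 s degι degκ X) (hY : IsHomMat 𝓑 s' degκ degτ Y) (h : s + s' = r) :
    IsHomMat 𝓑 r degι degτ (X * Y) := fun a c =>
  AddSubgroup.sum_mem _ fun b _ => P.mul_mem (hX a b) (hY b c) (by omega)

theorem IsHomMat.sub {X Y : Matrix ι κ B} (hX : IsHomMat 𝓑 s degι degκ X)
    (hY : IsHomMat 𝓑 s degι degκ Y) : IsHomMat 𝓑 s degι degκ (X - Y) := fun a b =>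
  AddSubgroup.sub_mem _ (hX a b) (hY a b)

theorem isHomMat_one [DecidableEq ι] (P : RingProj 𝓑) :
    IsHomMat 𝓑 0 degι degι (1 : Matrix ι ι B) := fun a b => by
  by_cases h : a = b
  · subst h
    simpa using P.one_mem
  · simp [Matrix.one_apply_ne h]

/-- A homogeneous matrix which factors through a homogeneous matrix has a homogeneous factor. -/
theorem IsHomMat.exists_factor [Fintype κ] (P : RingProj 𝓑) {D : Matrix ι κ B}
    {X : Matrix ι τ B} (hD : IsHomMat 𝓑 0 degι degκ D) (hX : IsHomMat 𝓑 s degι degτ X)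
    (h : ∃ W : Matrix κ τ B, D * W = X) : ∃ W : Matrix κ τ B, IsHomMat 𝓑 s degκ degτ W ∧ D * W = X := by
  obtain ⟨W, rfl⟩ := h
  -- Keep only the component of each entry of `W` in the required degree. As `D` is homogeneous,
  -- this replaces `D * W` by its component in the degree of `X`, which is all of it.
  refine ⟨Matrix.of fun b c => P.proj (degτ c + s - degκ b) (W b c), fun b c => P.proj_mem _ _, ?_⟩
  ext a c
  refine Eq.trans ?_ (P.proj_of_mem (hX a c))
  rw [Matrix.mul_apply, Matrix.mul_apply, map_sum]
  refine Finset.sum_congr rfl fun b _ => ?_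
  rw [Matrix.of_apply, mul_comm (D a b) (W b c), P.proj_mul (hD a b), mul_comm]
  congr 3
  omega

end HomMat

/-- Dependent choice, starting from a given element. -/
theorem exists_dependent_seq {X : ℕ → Type*} (p : ∀ i, X i → Prop)
    (R : ∀ i, X i → X (i + 1) → Prop) (x₀ : X 0) (h₀ : p 0 x₀)
    (h : ∀ i x, p i x → ∃ y, p (i + 1) y ∧ R i x y) :
    ∃ s : ∀ i, X i, s 0 = x₀ ∧ (∀ i, p i (s i)) ∧ ∀ i, R i (s i) (s (i + 1)) := by
  choose g hg using h
  let S : ∀ i, {x : X i // p i x} := fun i =>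
    Nat.rec ⟨x₀, h₀⟩ (fun i x => ⟨g i x.1 x.2, (hg i x.1 x.2).1⟩) i
  exact ⟨fun i => (S i).1, rfl, fun i => (S i).2, fun i => (hg i (S i).1 (S i).2).2⟩

variable {M N : Type u} [AddCommGroup M] [Module B M] [AddCommGroup N] [Module B N]
  {ℳ : ℤ → AddSubgroup M} {𝒩 : ℤ → AddSubgroup N}

theorem sum_mul_smul {ι κ : Type*} [Fintype ι] [Fintype κ] (X : Matrix ι κ B) (v : κ → B)
    (ε : ι → M) : ∑ a, (X.mulVec v) a • ε a = ∑ b, v b • ∑ a, X a b • ε a := by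
  simp only [Matrix.mulVec, dotProduct, Finset.sum_smul, Finset.smul_sum, smul_smul]
  rw [Finset.sum_comm]
  simp only [mul_comm]

theorem IsGradedFreeResolution.exists_factor_succ {G : GradedFreeComplex 𝓑} {ε : G.ι 0 → N}
    (hG : IsGradedFreeResolution 𝒩 G ε) {i : ℕ} {τ : Type*} {X : Matrix (G.ι (i + 1)) τ B}
    (h : G.d i * X = 0) : ∃ W : Matrix (G.ι (i + 2)) τ B, G.d (i + 1) * W = X := by
  have h1 : ∀ c, ∃ w, (G.d (i + 1)).mulVec w = fun b => X b c := fun c =>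
    hG.exact_succ i _ (by ext a; exact congrFun (congrFun h a) c)
  choose W hW using h1
  exact ⟨Matrix.of fun b c => W c b, by ext a c; exact congrFun (hW c) a⟩

theorem IsGradedFreeResolution.exists_factor_zero {G : GradedFreeComplex 𝓑} {ε : G.ι 0 → N}
    (hG : IsGradedFreeResolution 𝒩 G ε) {τ : Type*} {X : Matrix (G.ι 0) τ B}
    (h : ∀ c, ∑ a, X a c • ε a = 0) : ∃ W : Matrix (G.ι 1) τ B, G.d 0 * W = X := by
  have h1 : ∀ c, ∃ w, (G.d 0).mulVec w = fun b => X b c := fun c => hG.exact_zero _ (h c)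
  choose W hW using h1
  exact ⟨Matrix.of fun b c => W c b, by ext a c; exact congrFun (hW c) a⟩

/-- A linear map which is homogeneous of degree `s` lifts to graded free resolutions. -/
theorem exists_lift (P : RingProj 𝓑) (Q : ModProj P 𝒩) {F G : GradedFreeComplex 𝓑}
    {εF : F.ι 0 → M} {εG : G.ι 0 → N} (hF : IsGradedFreeResolution ℳ F εF)
    (hG : IsGradedFreeResolution 𝒩 G εG) (φ : M →ₗ[B] N) {s : ℤ}
    (hφ : ∀ q, ∀ x ∈ ℳ q, φ x ∈ 𝒩 (q + s)) :
    ∃ Φ : ∀ i, Matrix (G.ι i) (F.ι i) B, (∀ i, IsHomMat 𝓑 s (G.deg i) (F.deg i) (Φ i)) ∧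
      (∀ i, G.d i * Φ (i + 1) = Φ i * F.d i) ∧ ∀ b, ∑ a, Φ 0 a b • εG a = φ (εF b) := by
  choose W hW using fun b => hG.augmentation_surjective (φ (εF b))
  let Φ₀ : Matrix (G.ι 0) (F.ι 0) B :=
    Matrix.of fun a b => P.proj (F.deg 0 b + s - G.deg 0 a) (W b a)
  have h₀ : ∀ b, ∑ a, Φ₀ a b • εG a = φ (εF b) := fun b => by
    rw [← Q.proj_of_mem (hφ _ _ (hF.augmentation_degree b)), ← hW b,
      Q.proj_sum hG.augmentation_degree]
    rfl
  -- The invariant records that `X * F.d i` factors through `G.d i`. The augmentation provides this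
  -- at the start and exactness provides it later, so a single recursion serves both.
  obtain ⟨Φ, h1, h2, h3⟩ := exists_dependent_seq
    (fun i (X : Matrix (G.ι i) (F.ι i) B) => IsHomMat 𝓑 s (G.deg i) (F.deg i) X ∧
      ∃ W : Matrix (G.ι (i + 1)) (F.ι (i + 1)) B, G.d i * W = X * F.d i) (fun i X Y => G.d i * Y = X * F.d i) Φ₀
    ⟨fun a b => P.proj_mem _ _, hG.exists_factor_zero fun c => by
      have h4 := sum_mul_smul Φ₀ (fun b => F.d 0 b c) εG
      simp only [h₀, ← map_smul, ← map_sum, hF.augmentation_comp, map_zero] at h4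
      exact h4⟩ fun i X ⟨hX, hX'⟩ => by
    obtain ⟨W, hW, hW'⟩ := (G.isHomMat_d i).exists_factor P
      (hX.mul P (F.isHomMat_d i) (add_zero s)) hX'
    refine ⟨W, ⟨hW, hG.exists_factor_succ ?_⟩, hW'⟩
    rw [← Matrix.mul_assoc, hW', Matrix.mul_assoc, F.d_comp_d, Matrix.mul_zero]
  exact ⟨Φ, fun i => (h2 i).1, h3, h1 ▸ h₀⟩

/-- A chain map of graded free resolutions which lifts the zero map is null-homotopic. -/
theorem exists_homotopy (P : RingProj 𝓑) {F G : GradedFreeComplex 𝓑}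
    {εG : G.ι 0 → N} (hG : IsGradedFreeResolution 𝒩 G εG)
    (Φ : ∀ i, Matrix (G.ι i) (F.ι i) B) (hΦ : ∀ i, IsHomMat 𝓑 0 (G.deg i) (F.deg i) (Φ i))
    (hc : ∀ i, G.d i * Φ (i + 1) = Φ i * F.d i) (hz : ∀ b, ∑ a, Φ 0 a b • εG a = 0) :
    ∃ h : ∀ i, Matrix (G.ι (i + 1)) (F.ι i) B,
      (∀ i, IsHomMat 𝓑 0 (G.deg (i + 1)) (F.deg i) (h i)) ∧
      G.d 0 * h 0 = Φ 0 ∧ ∀ i, G.d (i + 1) * h (i + 1) + h i * F.d i = Φ (i + 1) := by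
  obtain ⟨h₀, h1, h2⟩ := (G.isHomMat_d 0).exists_factor P (hΦ 0) (hG.exists_factor_zero hz)
  -- The condition `G.d i * X * F.d i = Φ i * F.d i` is what remains of the homotopy identity after
  -- composing with `F.d i`. It says exactly that `Φ (i + 1) - X * F.d i` is killed by `G.d i`.
  obtain ⟨h, h3, h4, h5⟩ := exists_dependent_seq
    (fun i (X : Matrix (G.ι (i + 1)) (F.ι i) B) =>
      IsHomMat 𝓑 0 (G.deg (i + 1)) (F.deg i) X ∧ G.d i * X * F.d i = Φ i * F.d i)
    (fun i X Y => G.d (i + 1) * Y + X * F.d i = Φ (i + 1)) h₀ ⟨h1, by rw [h2]⟩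
    fun i X ⟨hX, hX'⟩ => by
      obtain ⟨Y, hY, hY'⟩ := (G.isHomMat_d (i + 1)).exists_factor P
        ((hΦ (i + 1)).sub (hX.mul P (F.isHomMat_d i) (add_zero 0)))
        (hG.exists_factor_succ (by
          rw [Matrix.mul_sub, hc, ← Matrix.mul_assoc, hX', sub_self]))
      refine ⟨Y, ⟨hY, ?_⟩, by rw [hY', sub_add_cancel]⟩
      rw [hY', Matrix.sub_mul, Matrix.mul_assoc X, F.d_comp_d, Matrix.mul_zero, sub_zero]
  exact ⟨h, fun i => (h4 i).1, h3 ▸ h2, h5⟩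

/-- The mapping cone of a lift of an injective map resolves the cokernel. -/
theorem IsGradedShortExact.cone_resolution {Q : Type u} [AddCommGroup Q] [Module B Q]
    {𝒬 : ℤ → AddSubgroup Q} {φ : M →ₗ[B] N} {ψ : N →ₗ[B] Q}
    (hs : IsGradedShortExact ℳ 𝒩 𝒬 φ ψ) {F G : GradedFreeComplex 𝓑}
    {εF : F.ι 0 → M} {εG : G.ι 0 → N} (hF : IsGradedFreeResolution ℳ F εF)
    (hG : IsGradedFreeResolution 𝒩 G εG) (Φ : F.Hom G) (hΦ : IsComparison φ εF εG Φ) :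
    IsGradedFreeResolution 𝒬 (cone Φ) (fun a : G.ι 0 => ψ (εG a)) := by
  have hεΦ : ∀ u, ∑ a, ((Φ.mat 0).mulVec u) a • εG a = φ (∑ b, u b • εF b) := fun u => by
    rw [sum_mul_smul]
    simp only [hΦ _, map_sum, map_smul]
  have hψ : ∀ v : G.ι 0 → B, ∑ a, v a • ψ (εG a) = ψ (∑ a, v a • εG a) := fun v => by
    simp only [map_sum, map_smul]
  have hεd : ∀ w, ∑ a, ((G.d 0).mulVec w) a • εG a = 0 := fun w => by
    rw [sum_mul_smul]
    simp [hG.augmentation_comp]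
  refine ⟨fun a => hs.degree_right _ _ (hG.augmentation_degree a), fun y => ?_, ?_, ?_, ?_⟩
  · obtain ⟨x, rfl⟩ := hs.surjective y
    obtain ⟨v, rfl⟩ := hG.augmentation_surjective x
    exact ⟨v, hψ v⟩
  · rintro (b | b)
    · exact (hψ fun a => G.d 0 a b).trans (by rw [hG.augmentation_comp, map_zero])
    · refine (hψ fun a => Φ.mat 0 a b).trans ?_
      rw [hΦ b]
      exact hs.exact.apply_apply_eq_zero _
  · intro (v : G.ι 0 → B) hv
    obtain ⟨m, hm⟩ := (hs.exact _).mp ((hψ v).symm.trans hv)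
    obtain ⟨u, rfl⟩ := hF.augmentation_surjective m
    obtain ⟨w, hw⟩ := hG.exact_zero (v - (Φ.mat 0).mulVec u) (by
      simp only [Pi.sub_apply, sub_smul, Finset.sum_sub_distrib, hεΦ, hm, sub_self])
    refine ⟨Sum.elim w u, ?_⟩
    exact (Matrix.fromCols_mulVec_sumElim _ _ _ _).trans (eq_sub_iff_add_eq.mp hw)
  · rintro (_ | i) v hv
    · obtain ⟨y, x, rfl⟩ : ∃ y x, v = Sum.elim y x := ⟨_, _, (Sum.elim_comp_inl_inr v).symm⟩
      have h1 : (G.d 0).mulVec y + (Φ.mat 0).mulVec x = 0 :=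
        (Matrix.fromCols_mulVec_sumElim _ _ _ _).symm.trans hv
      -- Injectivity of `φ` is needed only here: `Φ x` is a boundary up to sign, so `φ` kills the
      -- augmentation of `x`.
      obtain ⟨x', rfl⟩ := hF.exact_zero x (hs.injective (by
        rw [← hεΦ, map_zero, eq_neg_of_add_eq_zero_right h1]
        simp only [Pi.neg_apply, neg_smul, Finset.sum_neg_distrib, hεd, neg_zero]))
      obtain ⟨w, hw⟩ := hG.exact_succ 0 (y + (Φ.mat 1).mulVec x') (by
        rw [Matrix.mulVec_add, Matrix.mulVec_mulVec, Φ.comm 0, ← Matrix.mulVec_mulVec, h1])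
      -- The sign of `x'` compensates for the `-d` in the cone differential; `w` was chosen to
      -- absorb the resulting `-Φ x'`.
      refine ⟨Sum.elim w (-x'), (Matrix.fromBlocks_mulVec _ _ _ _ _).trans ?_⟩
      simp [hw, Matrix.mulVec_neg, Matrix.neg_mulVec]
    · obtain ⟨y, x, rfl⟩ : ∃ y x, v = Sum.elim y x := ⟨_, _, (Sum.elim_comp_inl_inr v).symm⟩
      have h1 := (Matrix.fromBlocks_mulVec _ _ _ _ _).symm.trans hv
      have h2 : (G.d (i + 1)).mulVec y + (Φ.mat (i + 1)).mulVec x = 0 :=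
        funext fun a => congrFun h1 (Sum.inl a)
      have h3 : (F.d i).mulVec x = 0 := funext fun a => by
        have h4 := congrFun h1 (Sum.inr a)
        rw [Sum.elim_inr, Matrix.zero_mulVec, zero_add, Matrix.neg_mulVec] at h4
        exact neg_eq_zero.mp h4
      obtain ⟨x', rfl⟩ := hF.exact_succ i x h3
      obtain ⟨w, hw⟩ := hG.exact_succ (i + 1) (y + (Φ.mat (i + 2)).mulVec x') (by
        rw [Matrix.mulVec_add, Matrix.mulVec_mulVec, Φ.comm (i + 1), ← Matrix.mulVec_mulVec, h2])
      refine ⟨Sum.elim w (-x'), (Matrix.fromBlocks_mulVec _ _ _ _ _).trans ?_⟩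
      simp [hw, Matrix.mulVec_neg, Matrix.neg_mulVec]

end Graded

/-! ### Graded Betti numbers and minimality of comparison maps. -/

section Residue

universe u

open Module

/-- `res` is the residue map of a graded ring whose degree zero elements with nonzero residue are
units. -/
structure RingProj.IsResidue {B : Type u} [CommRing B] {𝓑 : ℤ → AddSubgroup B} (P : RingProj 𝓑)
    {𝕜 : Type u} [Field 𝕜] (res : B →+* 𝕜) : Prop where
  res_of_ne : ∀ {q x}, x ∈ 𝓑 q → q ≠ 0 → res x = 0
  isUnit_proj : ∀ x, res x ≠ 0 → IsUnit (P.proj 0 x)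

variable {B : Type u} [CommRing B] {𝓑 : ℤ → AddSubgroup B} {P : RingProj 𝓑}
  {𝕜 : Type u} [Field 𝕜] {res : B →+* 𝕜}

section LinearAlgebra

variable {V₀ V₁ V₂ W₀ W₁ W₂ : Type*} [AddCommGroup V₀] [Module 𝕜 V₀] [AddCommGroup V₁]
  [Module 𝕜 V₁] [AddCommGroup V₂] [Module 𝕜 V₂] [AddCommGroup W₀] [Module 𝕜 W₀]
  [AddCommGroup W₁] [Module 𝕜 W₁] [AddCommGroup W₂] [Module 𝕜 W₂] [FiniteDimensional 𝕜 W₁]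

/-- Since `g ∘ f` is the identity up to boundaries, `f` is injective on homology. A homotopy on one
side gives the inequality; equality of Betti numbers later comes from exchanging the two complexes.
-/
theorem finrank_coker_le {d : V₂ →ₗ[𝕜] V₁} {d' : W₂ →ₗ[𝕜] W₁} {f : V₁ →ₗ[𝕜] W₁}
    {f' : V₂ →ₗ[𝕜] W₂} {g : W₁ →ₗ[𝕜] V₁} {g' : W₂ →ₗ[𝕜] V₂} {h : V₁ →ₗ[𝕜] V₂}
    (hf : d' ∘ₗ f' = f ∘ₗ d) (hg : d ∘ₗ g' = g ∘ₗ d') (hh : g ∘ₗ f = LinearMap.id + d ∘ₗ h) :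
    finrank 𝕜 (V₁ ⧸ LinearMap.range d) ≤ finrank 𝕜 (W₁ ⧸ LinearMap.range d') := by
  have hle : LinearMap.range d ≤ (LinearMap.range d').comap f := by
    rintro _ ⟨x, rfl⟩
    exact ⟨f' x, LinearMap.congr_fun hf x⟩
  refine LinearMap.finrank_le_finrank_of_injective
    (f := Submodule.mapQ _ _ f hle) ?_
  rw [← LinearMap.ker_eq_bot, LinearMap.ker_eq_bot']
  intro x
  obtain ⟨x, rfl⟩ := Submodule.Quotient.mk_surjective _ x
  intro hx
  rw [Submodule.mapQ_apply, Submodule.Quotient.mk_eq_zero] at hx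
  obtain ⟨y, hy⟩ := hx
  rw [Submodule.Quotient.mk_eq_zero]
  refine ⟨g' y - h x, ?_⟩
  have h1 := LinearMap.congr_fun hg y
  have h2 := LinearMap.congr_fun hh x
  simp only [LinearMap.comp_apply, LinearMap.add_apply, LinearMap.id_apply] at h1 h2
  rw [map_sub, h1, hy, h2, add_sub_cancel_right]

/-- The same argument in positive homological degree; the extra homotopy term `h₀ ∘ e` vanishes on
cycles. -/
theorem finrank_homology_le {d : V₂ →ₗ[𝕜] V₁} {d' : W₂ →ₗ[𝕜] W₁} {e : V₁ →ₗ[𝕜] V₀}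
    {e' : W₁ →ₗ[𝕜] W₀} {f₀ : V₀ →ₗ[𝕜] W₀} {f : V₁ →ₗ[𝕜] W₁}
    {f' : V₂ →ₗ[𝕜] W₂} {g : W₁ →ₗ[𝕜] V₁} {g' : W₂ →ₗ[𝕜] V₂} {h : V₁ →ₗ[𝕜] V₂}
    {h₀ : V₀ →ₗ[𝕜] V₁} (he : e' ∘ₗ f = f₀ ∘ₗ e)
    (hf : d' ∘ₗ f' = f ∘ₗ d) (hg : d ∘ₗ g' = g ∘ₗ d')
    (hh : g ∘ₗ f = LinearMap.id + (d ∘ₗ h + h₀ ∘ₗ e)) :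
    finrank 𝕜 (LinearMap.ker e ⧸ (LinearMap.range d).submoduleOf (LinearMap.ker e)) ≤
      finrank 𝕜 (LinearMap.ker e' ⧸ (LinearMap.range d').submoduleOf (LinearMap.ker e')) := by
  have hk : ∀ x ∈ LinearMap.ker e, f x ∈ LinearMap.ker e' := fun x hx => by
    have h1 := LinearMap.congr_fun he x
    simp only [LinearMap.comp_apply, LinearMap.mem_ker.mp hx, map_zero] at h1
    exact h1
  have hle : (LinearMap.range d).submoduleOf (LinearMap.ker e) ≤
      ((LinearMap.range d').submoduleOf (LinearMap.ker e')).comap (f.restrict hk) := by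
    rintro ⟨_, hx⟩ ⟨x, rfl⟩
    exact ⟨f' x, LinearMap.congr_fun hf x⟩
  refine LinearMap.finrank_le_finrank_of_injective
    (f := Submodule.mapQ _ _ (f.restrict hk) hle) ?_
  rw [← LinearMap.ker_eq_bot, LinearMap.ker_eq_bot']
  intro x
  obtain ⟨⟨x, hxk⟩, rfl⟩ := Submodule.Quotient.mk_surjective _ x
  intro hx
  rw [Submodule.mapQ_apply, Submodule.Quotient.mk_eq_zero] at hx
  obtain ⟨y, hy⟩ := hx
  rw [Submodule.Quotient.mk_eq_zero]
  refine ⟨g' y - h x, ?_⟩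
  have h1 := LinearMap.congr_fun hg y
  have h2 := LinearMap.congr_fun hh x
  simp only [LinearMap.comp_apply, LinearMap.add_apply, LinearMap.id_apply,
    LinearMap.mem_ker.mp hxk, map_zero, add_zero] at h1 h2
  replace hy : d' y = f x := hy
  change d _ = x
  rw [map_sub, h1, hy, h2, add_sub_cancel_right]

end LinearAlgebra

section ResMat

variable {ι κ τ : Type*} [Fintype κ] [Fintype τ] {degι : ι → ℤ} {degκ : κ → ℤ}
  {degτ : τ → ℤ}

/-- The degree `q` part of the reduction of a matrix modulo the irrelevant ideal. -/
def resMat (res : B →+* 𝕜) (q : ℤ) (degι : ι → ℤ) (degκ : κ → ℤ) (X : Matrix ι κ B) :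
    ({b : κ // degκ b = q} → 𝕜) →ₗ[𝕜] ({a : ι // degι a = q} → 𝕜) :=
  ((X.map res).submatrix Subtype.val Subtype.val).mulVecLin

/-- A term `X a b * Y b c` with `b` of another degree than `a` has residue zero, because `X a b` is
homogeneous of nonzero degree. So restricting to the indices of degree `q` loses nothing in the
product. -/
theorem resMat_mul (hP : P.IsResidue res) {X : Matrix ι κ B} (hX : IsHomMat 𝓑 0 degι degκ X)
    (Y : Matrix κ τ B) (q : ℤ) :
    resMat res q degι degτ (X * Y) = resMat res q degι degκ X ∘ₗ resMat res q degκ degτ Y := by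
  rw [resMat, resMat, resMat, ← Matrix.mulVecLin_mul]
  congr 1
  ext ⟨a, rfl⟩ c
  simp only [Matrix.submatrix_apply, Matrix.map_apply, Matrix.mul_apply, map_sum, map_mul]
  rw [← Finset.sum_subtype (Finset.univ.filter fun b => degκ b = degι a) (by simp)
    (fun b => res (X a b) * res (Y b c.1)), Finset.sum_filter_of_ne]
  intro b _ hb
  by_contra h
  exact hb (by rw [hP.res_of_ne (hX a b) (by omega), zero_mul])

theorem resMat_add (X Y : Matrix ι κ B) (q : ℤ) :
    resMat res q degι degκ (X + Y) = resMat res q degι degκ X + resMat res q degι degκ Y := by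
  rw [resMat, resMat, resMat, ← Matrix.mulVecLin_add]
  congr 1
  ext a b
  simp

theorem resMat_one [Fintype ι] [DecidableEq ι] (q : ℤ) :
    resMat res q degι degι (1 : Matrix ι ι B) = LinearMap.id := by
  rw [resMat, Matrix.map_one _ (map_zero _) (map_one _), Matrix.submatrix_one _
    Subtype.val_injective, Matrix.mulVecLin_one]

theorem resMat_eq_zero {X : Matrix ι κ B} (hX : ∀ a b, res (X a b) = 0) (q : ℤ) :
    resMat res q degι degκ X = 0 := by
  rw [resMat, ← Matrix.mulVecLin_zero]
  congr 1
  ext a b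
  exact hX a b

end ResMat

variable {M N : Type u} [AddCommGroup M] [Module B M] [AddCommGroup N] [Module B N]
  {ℳ : ℤ → AddSubgroup M} {𝒩 : ℤ → AddSubgroup N}

/-- Lift the identity of `M` in both directions. The round trip on `F` is homotopic to the identity,
so after reduction to `𝕜` the homology of `F` embeds in that of `G`. -/
theorem torDim_le (hP : P.IsResidue res) (Q : ModProj P ℳ) {F G : GradedFreeComplex 𝓑}
    {εF : F.ι 0 → M} {εG : G.ι 0 → M} (hF : IsGradedFreeResolution ℳ F εF)
    (hG : IsGradedFreeResolution ℳ G εG) (i : ℕ) (q : ℤ) :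
    F.torDim res i q ≤ G.torDim res i q := by
  classical
  obtain ⟨Φ, hΦ, hΦd, hΦε⟩ := exists_lift P Q hF hG LinearMap.id (s := 0) (by simp)
  obtain ⟨Ψ, hΨ, hΨd, hΨε⟩ := exists_lift P Q hG hF LinearMap.id (s := 0) (by simp)
  obtain ⟨h, hh, hh0, hhs⟩ := exists_homotopy P hF (fun i => Ψ i * Φ i - 1)
    (fun i => ((hΨ i).mul P (hΦ i) (add_zero 0)).sub (isHomMat_one P))
    (fun i => by
      rw [Matrix.mul_sub, Matrix.sub_mul, ← Matrix.mul_assoc, hΨd, Matrix.mul_assoc, hΦd,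
        Matrix.mul_assoc, Matrix.mul_one, Matrix.one_mul])
    (fun b => by
      have h1 := sum_mul_smul (Ψ 0) (fun a => Φ 0 a b) εF
      simp only [hΨε, LinearMap.id_apply, hΦε] at h1
      simp only [Matrix.sub_apply, sub_smul, Finset.sum_sub_distrib, Matrix.one_apply, ite_smul,
        one_smul, zero_smul, Finset.sum_ite_eq', Finset.mem_univ, if_true]
      exact sub_eq_zero.mpr h1)
  have hm : ∀ i, resMat res q (F.deg i) (F.deg i) (Ψ i * Φ i) =
      resMat res q (F.deg i) (G.deg i) (Ψ i) ∘ₗ resMat res q (G.deg i) (F.deg i) (Φ i) :=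
    fun i => resMat_mul hP (hΨ i) _ q
  have hΦr : ∀ i, G.resMap res i q ∘ₗ resMat res q _ _ (Φ (i + 1)) =
      resMat res q _ _ (Φ i) ∘ₗ F.resMap res i q := fun i => by
    have h1 := congrArg (resMat res q (G.deg i) (F.deg (i + 1))) (hΦd i)
    rwa [resMat_mul hP (G.isHomMat_d i), resMat_mul hP (hΦ i)] at h1
  have hΨr : ∀ i, F.resMap res i q ∘ₗ resMat res q _ _ (Ψ (i + 1)) =
      resMat res q _ _ (Ψ i) ∘ₗ G.resMap res i q := fun i => by
    have h1 := congrArg (resMat res q (F.deg i) (G.deg (i + 1))) (hΨd i)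
    rwa [resMat_mul hP (F.isHomMat_d i), resMat_mul hP (hΨ i)] at h1
  cases i with
  | zero =>
    refine finrank_coker_le (hΦr 0) (hΨr 0) (h := resMat res q _ _ (h 0)) ?_
    rw [← hm, ← sub_add_cancel (Ψ 0 * Φ 0) 1, ← hh0, resMat_add, resMat_one,
      resMat_mul hP (F.isHomMat_d 0)]
    exact add_comm _ _
  | succ i =>
    refine finrank_homology_le (hΦr i) (hΦr (i + 1)) (hΨr (i + 1))
      (h := resMat res q _ _ (h (i + 1))) (h₀ := resMat res q _ _ (h i)) ?_
    rw [← hm, ← sub_add_cancel (Ψ (i + 1) * Φ (i + 1)) 1, ← hhs, resMat_add, resMat_one,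
      resMat_add, resMat_mul hP (F.isHomMat_d (i + 1)), resMat_mul hP (hh i)]
    exact add_comm _ _

/-- Graded Betti numbers do not depend on the resolution. -/
theorem torDim_eq (hP : P.IsResidue res) (Q : ModProj P ℳ) {F G : GradedFreeComplex 𝓑}
    {εF : F.ι 0 → M} {εG : G.ι 0 → M} (hF : IsGradedFreeResolution ℳ F εF)
    (hG : IsGradedFreeResolution ℳ G εG) (i : ℕ) (q : ℤ) :
    F.torDim res i q = G.torDim res i q :=
  le_antisymm (torDim_le hP Q hF hG i q) (torDim_le hP Q hG hF i q)

theorem torDim_of_minimal {F : GradedFreeComplex 𝓑} (hF : ∀ i a b, res (F.d i a b) = 0) (i : ℕ)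
    (q : ℤ) : F.torDim res i q = Fintype.card {a : F.ι i // F.deg i a = q} := by
  have h0 : ∀ i, F.resMap res i q = 0 := fun i => resMat_eq_zero (hF i) q
  cases i with
  | zero =>
    have h1 : LinearMap.range (F.resMap res 0 q) = ⊥ := by rw [h0, LinearMap.range_zero]
    rw [GradedFreeComplex.torDim, (Submodule.quotEquivOfEqBot _ h1).finrank_eq,
      finrank_fintype_fun_eq_card]
  | succ i =>
    have h1 : (LinearMap.range (F.resMap res (i + 1) q)).submoduleOf
        (LinearMap.ker (F.resMap res i q)) = ⊥ := by
      rw [h0 (i + 1), LinearMap.range_zero]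
      exact (Submodule.comap_bot _).trans (Submodule.ker_subtype _)
    have h2 : LinearMap.ker (F.resMap res i q) = ⊤ := by rw [h0, LinearMap.ker_zero]
    rw [GradedFreeComplex.torDim, (Submodule.quotEquivOfEqBot _ h1).finrank_eq, h2, finrank_top,
      finrank_fintype_fun_eq_card]

theorem cone_res_eq_zero {F G : GradedFreeComplex 𝓑} (hF : ∀ i a b, res (F.d i a b) = 0)
    (hG : ∀ i a b, res (G.d i a b) = 0) {Φ : F.Hom G} (hΦ : ∀ i a b, res (Φ.mat i a b) = 0) :
    ∀ i a b, res ((cone Φ).d i a b) = 0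
  | 0, a, Sum.inl b => hG 0 a b
  | 0, a, Sum.inr b => hΦ 0 a b
  | i + 1, Sum.inl a, Sum.inl b => hG (i + 1) a b
  | i + 1, Sum.inl a, Sum.inr b => hΦ (i + 1) a b
  | _ + 1, Sum.inr _, Sum.inl _ => map_zero _
  | i + 1, Sum.inr a, Sum.inr b => (map_neg res (F.d i a b)).trans (by rw [hF, neg_zero])

/-- A comparison map of minimal resolutions over a multiple `z φ'` has entries in the irrelevant
ideal if `z` has positive degree, because it is homotopic to `z` times a lift of `φ'`. -/
theorem comparison_res_eq_zero (Q : ModProj P 𝒩) {φ φ' : M →ₗ[B] N}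
    {z : B} (hz : z ∈ 𝓑 1) (hres : res z = 0) (hφ : ∀ x, φ x = z • φ' x)
    (hφ' : ∀ q, ∀ x ∈ ℳ q, φ' x ∈ 𝒩 (q + -1)) {F G : GradedFreeComplex 𝓑}
    {εF : F.ι 0 → M} {εG : G.ι 0 → N} (hF : IsMinimalGradedFreeResolution res ℳ F εF)
    (hG : IsMinimalGradedFreeResolution res 𝒩 G εG) {Φ : F.Hom G}
    (hΦ : IsComparison φ εF εG Φ) (i : ℕ) (a : G.ι i) (b : F.ι i) : res (Φ.mat i a b) = 0 := by
  obtain ⟨Ψ, hΨ, hΨd, hΨε⟩ := exists_lift P Q hF.1 hG.1 φ' hφ'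
  obtain ⟨h, hh, hh0, hhs⟩ := exists_homotopy P hG.1 (fun i => Φ.mat i - z • Ψ i)
    (fun i a b => by
      refine AddSubgroup.sub_mem _ (by simpa using Φ.homogeneous i a b) ?_
      exact P.mul_mem hz (hΨ i a b) (by omega))
    (fun i => by
      rw [Matrix.mul_sub, Matrix.sub_mul, Matrix.mul_smul, Matrix.smul_mul, Φ.comm, hΨd])
    (fun b => by
      simp only [Matrix.sub_apply, Matrix.smul_apply, smul_eq_mul, sub_smul, mul_smul,
        Finset.sum_sub_distrib, ← Finset.smul_sum, hΨε, hΦ b, hφ, sub_self])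
  -- Here `X` is the homotopy term: each of its summands contains a differential of a minimal
  -- resolution, hence has residue zero. The other part `z • Ψ i` has residue zero because `z` does.
  have key : ∀ i (X : Matrix (G.ι i) (F.ι i) B), (∀ a b, res (X a b) = 0) →
      X = Φ.mat i - z • Ψ i → ∀ a b, res (Φ.mat i a b) = 0 := by
    rintro i X hX rfl a b
    simpa [hres] using hX a b
  cases i with
  | zero =>
    exact key 0 _ (fun a b => by simp [Matrix.mul_apply, hG.minimal]) hh0 a b
  | succ i =>
    exact key (i + 1) _ (fun a b => by simp [Matrix.mul_apply, hG.minimal, hF.minimal]) (hhs i) a b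

/-- A graded exact sequence whose left map is `z` times a map of degree `-1` gives a minimal cone
step. -/
theorem IsGradedShortExact.isMinimalConeStep {Q : Type u} [AddCommGroup Q] [Module B Q]
    {𝒬 : ℤ → AddSubgroup Q} {φ : M →ₗ[B] N} {ψ : N →ₗ[B] Q}
    (hs : IsGradedShortExact ℳ 𝒩 𝒬 φ ψ) (hP : P.IsResidue res) (PM : ModProj P ℳ)
    (PN : ModProj P 𝒩) (PQ : ModProj P 𝒬) {φ' : M →ₗ[B] N}
    {z : B} (hz : z ∈ 𝓑 1) (hres : res z = 0) (hφ : ∀ x, φ x = z • φ' x)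
    (hφ' : ∀ q, ∀ x ∈ ℳ q, φ' x ∈ 𝒩 (q + -1))
    (hM : ∃ (F : GradedFreeComplex 𝓑) (ε : F.ι 0 → M), IsMinimalGradedFreeResolution res ℳ F ε)
    (hN : ∃ (G : GradedFreeComplex 𝓑) (ε : G.ι 0 → N), IsMinimalGradedFreeResolution res 𝒩 G ε) :
    IsMinimalConeStep 𝓑 res ℳ 𝒩 𝒬 φ ψ := by
  have hcomp : ∀ (F G : GradedFreeComplex 𝓑) (εF : F.ι 0 → M) (εG : G.ι 0 → N),
      IsMinimalGradedFreeResolution res ℳ F εF → IsMinimalGradedFreeResolution res 𝒩 G εG →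
      ∃ Φ : F.Hom G, IsComparison φ εF εG Φ := fun F G εF εG hF hG => by
    obtain ⟨Φ, h1, h2, h3⟩ := exists_lift P PN hF.1 hG.1 φ (s := 0) (by
      simpa using hs.degree_left)
    exact ⟨⟨Φ, fun i a b => by simpa using h1 i a b, h2⟩, h3⟩
  have hcone : ∀ (F G : GradedFreeComplex 𝓑) (εF : F.ι 0 → M) (εG : G.ι 0 → N),
      IsMinimalGradedFreeResolution res ℳ F εF → IsMinimalGradedFreeResolution res 𝒩 G εG →
      ∀ Φ : F.Hom G, IsComparison φ εF εG Φ →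
        IsMinimalGradedFreeResolution res 𝒬 (cone Φ) (fun a : G.ι 0 => ψ (εG a)) :=
    fun F G εF εG hF hG Φ hΦ => ⟨hs.cone_resolution hF.1 hG.1 Φ hΦ,
      cone_res_eq_zero hF.minimal hG.minimal
        (comparison_res_eq_zero PN hz hres hφ hφ' hF hG hΦ)⟩
  refine ⟨hs, hM, hN, fun F G H εF εG εH hF hG hH q => ?_, hcomp, hcone⟩
  obtain ⟨F', εF', hF'⟩ := hM
  obtain ⟨G', εG', hG'⟩ := hN
  obtain ⟨Φ, hΦ⟩ := hcomp F' G' εF' εG' hF' hG'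
  have hC := hcone F' G' εF' εG' hF' hG' Φ hΦ
  -- Betti numbers may be computed from the minimal resolutions and their cone, where they just
  -- count basis elements; the cone has the basis of `G'` in degree `i + 1` together with that of
  -- `F'` in degree `i`.
  simp only [torDim_eq hP PM hF hF'.1, torDim_eq hP PN hG hG'.1, torDim_eq hP PQ hH hC.1,
    torDim_of_minimal hF'.minimal, torDim_of_minimal hG'.minimal, torDim_of_minimal hC.minimal]
  refine ⟨rfl, fun i => ?_⟩
  rw [← Fintype.card_sum]
  exact Fintype.card_congr (Equiv.subtypeSum (α := G'.ι (i + 1)) (β := F'.ι i))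

end Residue

/-! ### Existence of minimal graded free resolutions over a Noetherian graded ring. -/

section Existence

universe u v w

/-- A finitely generated submodule which is spanned by elements of a set `𝓗` has a finite
irredundant system of generators in `𝓗`. -/
theorem exists_irredundant_generators {B : Type u} [CommRing B] {M : Type v} [AddCommGroup M]
    [Module B M] (𝓗 : Set M) (hN : (Submodule.span B 𝓗).FG) :
    ∃ s : Finset M, (s : Set M) ⊆ 𝓗 ∧ Submodule.span B (s : Set M) = Submodule.span B 𝓗 ∧
      ∀ x ∈ s, x ∉ Submodule.span B ((s : Set M) \ {x}) := by
  classical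
  have hex : ∃ k, ∃ s : Finset M, (s : Set M) ⊆ 𝓗 ∧
      Submodule.span B (s : Set M) = Submodule.span B 𝓗 ∧ s.card = k := by
    obtain ⟨s, hs, hs'⟩ := Submodule.fg_span_iff_fg_span_finset_subset _ |>.mp hN
    exact ⟨_, s, hs, hs'.symm, rfl⟩
  obtain ⟨s, hs, hs', hk⟩ := Nat.find_spec hex
  refine ⟨s, hs, hs', fun x hx hmem => ?_⟩
  have h1 : Submodule.span B ((s.erase x : Finset M) : Set M) = Submodule.span B 𝓗 := by
    rw [← hs', Finset.coe_erase, ← Submodule.span_insert_eq_span hmem, Set.insert_sdiff_singleton,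
      Set.insert_eq_of_mem (Finset.mem_coe.mpr hx)]
  have h2 := Nat.find_min' hex ⟨s.erase x, fun y hy => hs (Finset.erase_subset _ _ hy), h1, rfl⟩
  rw [← hk] at h2
  exact absurd h2 (not_le.mpr (Finset.card_erase_lt_of_mem hx))

theorem exists_irredundant_family {B : Type u} [CommRing B] {M : Type v} [AddCommGroup M]
    [Module B M] (𝓗 : Set M) (hN : (Submodule.span B 𝓗).FG) :
    ∃ (m : ℕ) (g : Fin m → M), (∀ a, g a ∈ 𝓗) ∧
      Submodule.span B (Set.range g) = Submodule.span B 𝓗 ∧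
      ∀ a, g a ∉ Submodule.span B (g '' {a' | a' ≠ a}) := by
  obtain ⟨s, hs, hs', hi⟩ := exists_irredundant_generators 𝓗 hN
  let e := s.equivFin.symm
  have hr : Set.range (fun a => (e a : M)) = s := by
    rw [show (fun a => (e a : M)) = Subtype.val ∘ e from rfl, e.surjective.range_comp,
      Subtype.range_coe_subtype]
    rfl
  refine ⟨s.card, fun a => e a, fun a => hs (e a).2, by rw [hr, hs'], fun a hmem => ?_⟩
  refine hi _ (e a).2 (Submodule.span_mono ?_ hmem)
  rintro _ ⟨a', ha', rfl⟩
  exact ⟨(e a').2, fun h => ha' (e.injective (Subtype.ext h))⟩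

variable {B : Type u} [CommRing B] {𝓑 : ℤ → AddSubgroup B}

/-- The grading of `⨁ a, B(-deg a)`. -/
def freeGrading (𝓑 : ℤ → AddSubgroup B) {ι : Type w} (deg : ι → ℤ) (q : ℤ) :
    AddSubgroup (ι → B) where
  carrier := {v | ∀ a, v a ∈ 𝓑 (q - deg a)}
  zero_mem' _ := AddSubgroup.zero_mem _
  add_mem' hv hw a := AddSubgroup.add_mem _ (hv a) (hw a)
  neg_mem' hv a := AddSubgroup.neg_mem _ (hv a)

/-- The projections onto the homogeneous components of a graded free module. -/
def RingProj.free (P : RingProj 𝓑) {ι : Type w} [Fintype ι] (deg : ι → ℤ) :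
    ModProj P (freeGrading 𝓑 deg) where
  proj q := AddMonoidHom.mk' (fun v a => P.proj (q - deg a) (v a)) fun v w => by
    ext a
    simp
  proj_mem q v a := P.proj_mem _ _
  proj_of_mem hv := funext fun a => P.proj_of_mem (hv a)
  proj_smul {p v} hv q b := funext fun a => by
    refine (P.proj_mul (hv a) (q - deg a) b).trans ?_
    rw [sub_sub_sub_cancel_right]
    rfl
  exists_sum v := by
    classical
    choose s hs using fun a => P.exists_sum (v a)
    -- The coordinates are shifted by different degrees, so one finite set must contain all shifted
    -- supports. This is why `RingProj.exists_sum` allows the index set to be enlarged.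
    refine ⟨Finset.univ.biUnion fun a => (s a).map (addRightEmbedding (deg a)), funext fun a => ?_⟩
    rw [Finset.sum_apply]
    refine Eq.trans ?_ (hs a ((Finset.univ.biUnion fun a =>
      (s a).map (addRightEmbedding (deg a))).map (addRightEmbedding (-deg a))) fun q hq => ?_)
    · rw [Finset.sum_map]
      rfl
    · refine Finset.mem_map.mpr ⟨q + deg a, Finset.mem_biUnion.mpr ⟨a, Finset.mem_univ a,
        Finset.mem_map.mpr ⟨q, hq, rfl⟩⟩, ?_⟩
      simp

variable {P : RingProj 𝓑} {M : Type v} [AddCommGroup M] [Module B M] {ℳ : ℤ → AddSubgroup M}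

/-- A finitely generated graded submodule has a finite irredundant system of homogeneous
generators. -/
theorem ModProj.exists_minimal_generators (Q : ModProj P ℳ) (N : Submodule B M) (hN : N.FG)
    (hQ : ∀ q, ∀ x ∈ N, Q.proj q x ∈ N) :
    ∃ (m : ℕ) (g : Fin m → M) (deg : Fin m → ℤ), (∀ a, g a ∈ ℳ (deg a)) ∧
      Submodule.span B (Set.range g) = N ∧
      ∀ a, g a ∉ Submodule.span B (g '' {a' | a' ≠ a}) := by
  have hspan : Submodule.span B {x | x ∈ N ∧ ∃ q, x ∈ ℳ q} = N := by
    refine le_antisymm (Submodule.span_le.mpr fun x hx => hx.1) fun x hx => ?_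
    obtain ⟨s, hs⟩ := Q.exists_sum x
    rw [← hs]
    exact Submodule.sum_mem _ fun q _ => Submodule.subset_span ⟨hQ q x hx, q, Q.proj_mem q x⟩
  obtain ⟨m, g, hg, hg', hi⟩ := exists_irredundant_family {x | x ∈ N ∧ ∃ q, x ∈ ℳ q}
    (by rwa [hspan])
  choose deg hdeg using fun a => (hg a).2
  exact ⟨m, g, deg, hdeg, hg'.trans hspan, hi⟩

/-- The relations between irredundant homogeneous generators have coefficients in the irrelevant
ideal. -/
theorem ModProj.res_eq_zero_of_relation (Q : ModProj P ℳ) {𝕜 : Type u} [Field 𝕜] {res : B →+* 𝕜}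
    (hP : P.IsResidue res) {ι : Type w} [Fintype ι] {g : ι → M} {deg : ι → ℤ}
    (hg : ∀ a, g a ∈ ℳ (deg a)) (hi : ∀ a, g a ∉ Submodule.span B (g '' {a' | a' ≠ a}))
    {v : ι → B} (hv : ∑ a, v a • g a = 0) (a : ι) : res (v a) = 0 := by
  classical
  by_contra hne
  obtain ⟨u, hu⟩ := hP.isUnit_proj _ hne
  -- In the component of degree `deg a` of the relation, `g a` has as coefficient the degree-zero
  -- part of `v a`. This is a unit, so `g a` would be redundant.
  have h1 := Q.proj_sum hg (deg a) v
  rw [hv, map_zero, ← Finset.add_sum_erase _ _ (Finset.mem_univ a), sub_self, ← hu] at h1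
  refine hi a ?_
  rw [← inv_smul_smul u (g a), Units.smul_def u⁻¹, Units.smul_def u,
    eq_neg_of_add_eq_zero_left h1.symm]
  refine Submodule.smul_mem _ _ ?_
  exact Submodule.neg_mem _ (Submodule.sum_mem _ fun b hb => Submodule.smul_mem _ _
    (Submodule.subset_span ⟨b, Finset.ne_of_mem_erase hb, rfl⟩))

/-- A graded module of relations, with coefficients in the irrelevant ideal. -/
structure Syzygy (P : RingProj 𝓑) {𝕜 : Type u} [Field 𝕜] (res : B →+* 𝕜) where
  rank : ℕ
  deg : Fin rank → ℤ
  relations : Submodule B (Fin rank → B)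
  proj_mem : ∀ q, ∀ v ∈ relations, (P.free deg).proj q v ∈ relations
  res_eq_zero : ∀ v ∈ relations, ∀ a, res (v a) = 0

/-- The relations between irredundant homogeneous generators. -/
def ModProj.syzygy (Q : ModProj P ℳ) {𝕜 : Type u} [Field 𝕜] {res : B →+* 𝕜}
    (hP : P.IsResidue res) {m : ℕ} {g : Fin m → M} {deg : Fin m → ℤ}
    (hg : ∀ a, g a ∈ ℳ (deg a)) (hi : ∀ a, g a ∉ Submodule.span B (g '' {a' | a' ≠ a})) :
    Syzygy P res where
  rank := m
  deg := deg
  relations := LinearMap.ker (Fintype.linearCombination B g)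
  proj_mem q v hv := by
    rw [LinearMap.mem_ker, Fintype.linearCombination_apply] at hv ⊢
    refine (Q.proj_sum hg q v).symm.trans ?_
    rw [hv, map_zero]
  res_eq_zero v hv := Q.res_eq_zero_of_relation hP hg hi
    (by rwa [LinearMap.mem_ker, Fintype.linearCombination_apply] at hv)

section Resolution

variable {𝕜 : Type u} [Field 𝕜] {res : B →+* 𝕜} [IsNoetherianRing B]

/-- Irredundant homogeneous generators of the relations become the columns of the next differential.
Their own relations again have irrelevant coefficients, so the construction can be repeated and
yields minimal differentials. -/
theorem Syzygy.exists_next (hP : P.IsResidue res) (Z : Syzygy P res) :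
    ∃ (Z' : Syzygy P res) (D : Matrix (Fin Z.rank) (Fin Z'.rank) B),
      (∀ a b, D a b ∈ 𝓑 (Z'.deg b - Z.deg a)) ∧
      (∀ v, v ∈ Z.relations ↔ ∃ w, D.mulVec w = v) ∧
      ∀ w, w ∈ Z'.relations ↔ D.mulVec w = 0 := by
  obtain ⟨m, g, deg, hg, hs, hi⟩ := (P.free Z.deg).exists_minimal_generators Z.relations
    (IsNoetherian.noetherian _) Z.proj_mem
  have hD : ∀ w : Fin m → B, (Matrix.of fun a b => g b a : Matrix (Fin Z.rank) (Fin m) B).mulVec w =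
      ∑ b, w b • g b := fun w => by
    ext a
    simp [Matrix.mulVec, dotProduct, mul_comm]
  refine ⟨(P.free Z.deg).syzygy hP hg hi, Matrix.of fun a b => g b a, fun a b => hg b a,
    fun v => ?_, fun w => ?_⟩
  · rw [← hs, Submodule.mem_span_range_iff_exists_fun]
    exact exists_congr fun w => ⟨(hD w).trans, (hD w).symm.trans⟩
  · exact (LinearMap.mem_ker (f := Fintype.linearCombination B g)).trans
      ⟨(hD w).trans, (hD w).symm.trans⟩

/-- Finitely generated graded modules have minimal graded free resolutions. -/
theorem ModProj.exists_minimal_resolution {M : Type u} [AddCommGroup M] [Module B M]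
    {ℳ : ℤ → AddSubgroup M} (Q : ModProj P ℳ) (hP : P.IsResidue res) (hM : Module.Finite B M) :
    ∃ (F : GradedFreeComplex 𝓑) (ε : F.ι 0 → M), IsMinimalGradedFreeResolution res ℳ F ε := by
  obtain ⟨m, g, deg, hg, hs, hi⟩ := Q.exists_minimal_generators ⊤ hM.1 fun _ _ _ => trivial
  choose next D hDh hDr hDk using Syzygy.exists_next (P := P) (res := res) hP
  let Z : ℕ → Syzygy P res := fun i => Nat.rec (Q.syzygy hP hg hi) (fun _ z => next z) i
  have hdd : ∀ i w, (D (Z i)).mulVec ((D (Z (i + 1))).mulVec w) = 0 := fun i w =>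
    (hDk (Z i) _).mp ((hDr (Z (i + 1)) _).mpr ⟨w, rfl⟩)
  let F : GradedFreeComplex 𝓑 :=
    { ι := fun i => Fin (Z i).rank
      deg := fun i => (Z i).deg
      d := fun i => D (Z i)
      homogeneous := fun i => hDh (Z i)
      d_comp_d := fun i => Matrix.ext_of_mulVec_single fun b => by
        rw [← Matrix.mulVec_mulVec, Matrix.zero_mulVec]
        exact hdd i _ }
  have hrel : ∀ v : Fin m → B, v ∈ (Z 0).relations ↔ ∑ a, v a • g a = 0 := fun v =>
    LinearMap.mem_ker
  have hcol : ∀ i b, (fun a => D (Z i) a b) ∈ (Z i).relations := fun i b =>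
    (hDr (Z i) _).mpr ⟨Pi.single b 1, by ext a; simp⟩
  refine ⟨F, g, ⟨hg, fun x => ?_, fun b => (hrel _).mp (hcol 0 b), fun v hv => ?_,
    fun i v hv => ?_⟩, fun i a b => (Z i).res_eq_zero _ (hcol i b) a⟩
  · exact Submodule.mem_span_range_iff_exists_fun B |>.mp (hs ▸ Submodule.mem_top)
  · exact (hDr (Z 0) v).mp ((hrel v).mpr hv)
  · exact (hDr (Z (i + 1)) v).mp ((hDk (Z i) v).mpr hv)

end Resolution

end Existence

/-! ### The gradings and residue maps of `A` and `B`, and their graded cyclic modules. -/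

section PolynomialRings

universe u

open Polynomial (C X)

variable (𝕜 : Type u) [Field 𝕜] (n : ℕ)

theorem gradingA_natCast (d : ℕ) (p : PolyA 𝕜 n) : p ∈ gradingA 𝕜 n d ↔ p.IsHomogeneous d := by
  refine forall_congr' fun m => forall_congr' fun _ => ?_
  rw [Nat.cast_inj, Finsupp.degree_eq_weight_one]
  rfl

/-- The projection of `A` onto its component of degree `q`. -/
noncomputable def projA (q : ℤ) : PolyA 𝕜 n →+ PolyA 𝕜 n :=
  if 0 ≤ q then (MvPolynomial.homogeneousComponent q.toNat).toAddMonoidHom else 0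

variable {𝕜 n}

theorem coeff_projA (q : ℤ) (p : PolyA 𝕜 n) (m : Fin n →₀ ℕ) :
    (projA 𝕜 n q p).coeff m = if (m.degree : ℤ) = q then p.coeff m else 0 := by
  rw [projA]
  split_ifs with h1 h2 h2
  · refine (MvPolynomial.coeff_homogeneousComponent _ _ _).trans (if_pos ?_)
    omega
  · refine (MvPolynomial.coeff_homogeneousComponent _ _ _).trans (if_neg ?_)
    omega
  · omega
  · simp

theorem projA_natCast (d : ℕ) (p : PolyA 𝕜 n) :
    projA 𝕜 n d p = MvPolynomial.homogeneousComponent d p := by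
  ext m
  rw [coeff_projA, MvPolynomial.coeff_homogeneousComponent]
  simp only [Nat.cast_inj]

theorem projA_neg {q : ℤ} (hq : q < 0) (p : PolyA 𝕜 n) : projA 𝕜 n q p = 0 := by
  rw [projA, if_neg (not_le.mpr hq)]
  rfl

theorem projA_mem (q : ℤ) (p : PolyA 𝕜 n) : projA 𝕜 n q p ∈ gradingA 𝕜 n q := fun m hm => by
  rw [coeff_projA] at hm
  by_contra h
  exact hm (if_neg h)

theorem projA_of_mem {q : ℤ} {p : PolyA 𝕜 n} (hp : p ∈ gradingA 𝕜 n q) : projA 𝕜 n q p = p := by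
  ext m
  rw [coeff_projA]
  split_ifs with h
  · rfl
  · by_contra h1
    exact h (hp m (Ne.symm h1))

theorem projA_mul {r : ℤ} {b : PolyA 𝕜 n} (hb : b ∈ gradingA 𝕜 n r) (q : ℤ) (p : PolyA 𝕜 n) :
    projA 𝕜 n q (p * b) = projA 𝕜 n (q - r) p * b := by
  classical
  ext m
  rw [coeff_projA, MvPolynomial.coeff_mul, MvPolynomial.coeff_mul]
  refine Eq.trans (b := ∑ x ∈ Finset.HasAntidiagonal.antidiagonal m, if (m.degree : ℤ) = q then
    p.coeff x.1 * b.coeff x.2 else 0) (by split_ifs <;> simp) ?_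
  refine Finset.sum_congr rfl fun x hx => ?_
  rw [coeff_projA]
  by_cases hx2 : b.coeff x.2 = 0
  · simp [hx2]
  · have h1 := hb _ hx2
    have h2 : (m.degree : ℤ) = x.1.degree + x.2.degree := by
      rw [← Finset.HasAntidiagonal.mem_antidiagonal.mp hx, map_add]
      push_cast
      rfl
    by_cases h3 : (m.degree : ℤ) = q
    · rw [if_pos h3, if_pos (by omega)]
    · rw [if_neg h3, if_neg (by omega), zero_mul]

theorem sum_projA (p : PolyA 𝕜 n) : ∃ s : Finset ℤ, ∀ s', s ⊆ s' → ∑ q ∈ s', projA 𝕜 n q p = p := by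
  refine ⟨p.support.image fun m => (m.degree : ℤ), fun s' hs => ?_⟩
  ext m
  rw [MvPolynomial.coeff_sum]
  simp only [coeff_projA, Finset.sum_ite_eq]
  split_ifs with h
  · rfl
  · by_contra h1
    exact h (hs (Finset.mem_image_of_mem _ (MvPolynomial.mem_support_iff.mpr (Ne.symm h1))))

variable (𝕜 n)

/-- The homogeneous projections of `A`. -/
noncomputable def ringProjA : RingProj (gradingA 𝕜 n) where
  proj := projA 𝕜 n
  one_mem := (gradingA_natCast 𝕜 n 0 1).mpr (MvPolynomial.isHomogeneous_one _ _)
  proj_mem := projA_mem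
  proj_of_mem := projA_of_mem
  proj_mul := projA_mul
  exists_sum := sum_projA

/-- The projection of `B` onto its component of degree `q`. -/
noncomputable def projB (q : ℤ) : PolyB 𝕜 n →+ PolyB 𝕜 n where
  toFun p := p.sum fun i a => Polynomial.monomial i (projA 𝕜 n (q - i) a)
  map_zero' := Polynomial.sum_zero_index _
  map_add' p r := Polynomial.sum_add_index p r _ (by simp) (by simp)

variable {𝕜 n}

theorem coeff_projB (q : ℤ) (p : PolyB 𝕜 n) (i : ℕ) :
    (projB 𝕜 n q p).coeff i = projA 𝕜 n (q - i) (p.coeff i) := by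
  change (p.sum fun i a => Polynomial.monomial i (projA 𝕜 n (q - i) a)).coeff i = _
  rw [Polynomial.sum_def, Polynomial.finsetSum_coeff]
  simp only [Polynomial.coeff_monomial, Finset.sum_ite_eq']
  split_ifs with h
  · rfl
  · rw [Polynomial.notMem_support_iff.mp h, map_zero]

variable (𝕜 n)

/-- The homogeneous projections of `B`. -/
noncomputable def ringProjB : RingProj (gradingB 𝕜 n) where
  proj := projB 𝕜 n
  one_mem := C_mem_gradingB 𝕜 n 0 1 (ringProjA 𝕜 n).one_mem
  proj_mem q p i := by
    rw [coeff_projB]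
    exact projA_mem _ _
  proj_of_mem {q p} hp := by
    ext1 i
    rw [coeff_projB, projA_of_mem (hp i)]
  proj_mul {r b} hb q p := by
    ext1 i
    rw [coeff_projB, Polynomial.coeff_mul, Polynomial.coeff_mul, map_sum]
    refine Finset.sum_congr rfl fun x hx => ?_
    rw [projA_mul (hb x.2), coeff_projB]
    congr 3
    have := Finset.HasAntidiagonal.mem_antidiagonal.mp hx
    omega
  exists_sum p := by
    classical
    choose s hs using fun i => sum_projA (p.coeff i)
    refine ⟨p.support.biUnion fun i => (s i).map (addRightEmbedding (i : ℤ)), fun s' hs' => ?_⟩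
    ext1 i
    rw [Polynomial.finsetSum_coeff]
    simp only [coeff_projB]
    by_cases hi : i ∈ p.support
    · refine Eq.trans ?_ (hs i (s'.map (addRightEmbedding (-(i : ℤ)))) fun q hq => ?_)
      · rw [Finset.sum_map]
        rfl
      · refine Finset.mem_map.mpr ⟨q + i, hs' (Finset.mem_biUnion.mpr ⟨i, hi,
          Finset.mem_map.mpr ⟨q, hq, rfl⟩⟩), ?_⟩
        simp
    · simp [Polynomial.notMem_support_iff.mp hi]

theorem isResidue_resA : (ringProjA 𝕜 n).IsResidue (resA 𝕜 n) where
  res_of_ne {q x} hx hq := by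
    by_contra h
    exact hq (by simpa using (hx 0 h).symm)
  isUnit_proj x hx := by
    have h1 : projA 𝕜 n 0 x = MvPolynomial.C (MvPolynomial.constantCoeff x) := by
      refine (projA_natCast 0 x).trans ?_
      rw [MvPolynomial.homogeneousComponent_zero]
      rfl
    change IsUnit (projA 𝕜 n 0 x)
    rw [h1]
    exact (IsUnit.mk0 _ hx).map MvPolynomial.C

theorem isResidue_resB : (ringProjB 𝕜 n).IsResidue (resB 𝕜 n) where
  res_of_ne {q x} hx hq := (isResidue_resA 𝕜 n).res_of_ne (hx 0) (by simpa using hq)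
  isUnit_proj x hx := by
    have h1 : projB 𝕜 n 0 x = C (projA 𝕜 n 0 (x.coeff 0)) := by
      ext1 i
      rw [coeff_projB]
      cases i with
      | zero => simp
      | succ i => rw [projA_neg (by push_cast; omega), Polynomial.coeff_C_succ]
    change IsUnit (projB 𝕜 n 0 x)
    rw [h1]
    exact ((isResidue_resA 𝕜 n).isUnit_proj _ hx).map C

variable {𝕜 n}

theorem X_mem_gradingB : (X : PolyB 𝕜 n) ∈ gradingB 𝕜 n 1 := fun i => by
  rw [Polynomial.coeff_X]
  split_ifs with h
  · subst h
    simpa using (ringProjA 𝕜 n).one_mem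
  · exact AddSubgroup.zero_mem _

theorem C_mul_X_pow_mem_gradingB {f : PolyA 𝕜 n} {d : ℕ} (hf : f.IsHomogeneous d) {j : ℕ} {q : ℤ}
    (hq : q = d + j) : (C f * X ^ j : PolyB 𝕜 n) ∈ gradingB 𝕜 n q := fun i => by
  rw [Polynomial.coeff_C_mul_X_pow]
  split_ifs with h
  · rw [hq, h, add_sub_cancel_right]
    exact (gradingA_natCast 𝕜 n d f).mpr hf
  · exact AddSubgroup.zero_mem _

/-- An ideal is closed under the projections onto homogeneous components. -/
def IsProjClosed {B : Type u} [CommRing B] {𝓑 : ℤ → AddSubgroup B} (P : RingProj 𝓑)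
    (I : Ideal B) : Prop :=
  ∀ q, ∀ x ∈ I, P.proj q x ∈ I

theorem isProjClosed_span {B : Type u} [CommRing B] {𝓑 : ℤ → AddSubgroup B} (P : RingProj 𝓑)
    {s : Set B} (hs : ∀ x ∈ s, ∃ q, x ∈ 𝓑 q) : IsProjClosed P (Ideal.span s) := fun q x hx => by
  obtain ⟨m, f, g, rfl⟩ := Submodule.mem_span_set'.mp hx
  rw [map_sum]
  refine Ideal.sum_mem _ fun i _ => ?_
  obtain ⟨p, hp⟩ := hs _ (g i).2
  rw [smul_eq_mul, P.proj_mul hp]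
  exact Ideal.mul_mem_left _ _ (Ideal.subset_span (g i).2)

/-- The projections onto the homogeneous components of a graded cyclic module. -/
noncomputable def RingProj.cyclic {B : Type u} [CommRing B] {𝓑 : ℤ → AddSubgroup B}
    (P : RingProj 𝓑) (Q : Type u) [CommRing Q] [Algebra B Q]
    (hQ : Function.Surjective (algebraMap B Q))
    (hI : IsProjClosed P (RingHom.ker (algebraMap B Q))) (e : ℤ) :
    ModProj P (cyclicGrading 𝓑 Q e) :=
  -- An arbitrary representative is projected. Since the kernel is closed under projections, `hp`
  -- shows that the choice does not matter.
  let p : ℤ → Q → Q := fun q x => algebraMap B Q (P.proj (q - e) (Function.surjInv hQ x))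
  have hp : ∀ q b, p q (algebraMap B Q b) = algebraMap B Q (P.proj (q - e) b) := fun q b => by
    rw [← sub_eq_zero, ← map_sub, ← map_sub]
    refine hI _ _ ?_
    rw [RingHom.mem_ker, map_sub, Function.surjInv_eq hQ, sub_self]
  { proj q := AddMonoidHom.mk' (p q) fun x y => by
      obtain ⟨x, rfl⟩ := hQ x
      obtain ⟨y, rfl⟩ := hQ y
      rw [← map_add, hp, hp, hp, map_add, map_add]
    proj_mem q x := ⟨_, P.proj_mem _ _, rfl⟩
    proj_of_mem := by
      rintro q _ ⟨b, hb, rfl⟩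
      exact (hp q b).trans (congrArg _ (P.proj_of_mem hb))
    proj_smul := by
      rintro r _ ⟨m, hm, rfl⟩ q b
      change p q (b • algebraMap B Q m) = _ • algebraMap B Q m
      rw [Algebra.smul_def, Algebra.smul_def, ← map_mul, ← map_mul, hp, P.proj_mul hm,
        sub_sub_sub_cancel_right]
    exists_sum x := by
      obtain ⟨x, rfl⟩ := hQ x
      obtain ⟨s, hs⟩ := P.exists_sum x
      refine ⟨s.map (addRightEmbedding e), ?_⟩
      rw [Finset.sum_map]
      refine Eq.trans ?_ (congrArg (algebraMap B Q) (hs s subset_rfl))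
      rw [map_sum]
      refine Finset.sum_congr rfl fun q _ => (hp _ _).trans ?_
      simp }

end PolynomialRings

/-! ### Base change from `A` to `B`, and single cone steps for cyclic modules. -/

section Steps

universe u

open Polynomial (C X)

variable {𝕜 : Type u} [Field 𝕜] {n : ℕ}

section BaseChange

variable {A : Type u} [CommRing A] {ι κ : Type*} [Fintype κ]

/-- A linear system over `A[z]` whose matrix has entries in `A` decouples into one system for each
power of `z`. Only the finitely many powers occurring in `v` matter, so the solutions assemble to
polynomials. This is the exactness of base change to `A[z]`. -/
theorem exists_mulVec_map_C (D : Matrix ι κ A) {v : ι → Polynomial A} [Finite ι]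
    (h : ∀ k, ∃ w, D.mulVec w = fun a => (v a).coeff k) :
    ∃ W : κ → Polynomial A, (D.map C).mulVec W = v := by
  classical
  have := Fintype.ofFinite ι
  choose w hw using h
  let S : Finset ℕ := Finset.univ.biUnion fun a => (v a).support
  have hS : ∀ k ∉ S, ∀ a, (v a).coeff k = 0 := fun k hk a =>
    Polynomial.notMem_support_iff.mp fun h =>
      hk (Finset.mem_biUnion.mpr ⟨a, Finset.mem_univ a, h⟩)
  refine ⟨fun b => ∑ k ∈ S, Polynomial.monomial k (w k b), funext fun a => ?_⟩
  ext1 k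
  simp only [Matrix.mulVec, dotProduct, Matrix.map_apply, Polynomial.finsetSum_coeff,
    Polynomial.coeff_C_mul, Polynomial.coeff_monomial, Finset.sum_ite_eq']
  by_cases hk : k ∈ S
  · simp only [hk, if_true]
    exact congrFun (hw k) a
  · simp [hk, hS k hk a]

theorem coeff_mulVec_map_C (D : Matrix ι κ A) (v : κ → Polynomial A) (a : ι) (k : ℕ) :
    ((D.map C).mulVec v a).coeff k = D.mulVec (fun b => (v b).coeff k) a := by
  simp [Matrix.mulVec, dotProduct, Polynomial.finsetSum_coeff]

end BaseChange

/-- A minimal graded free resolution stays one after adjoining a variable. -/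
theorem IsMinResA.baseChange {I : Ideal (PolyA 𝕜 n)} {K : Ideal (PolyB 𝕜 n)} (hK : K = I.map C)
    (h : I ≤ K.comap C) {P : GradedFreeComplex (gradingA 𝕜 n)} {ε : P.ι 0 → PolyA 𝕜 n ⧸ I}
    (hP : IsMinResA I P ε) :
    IsMinResB (PolyB 𝕜 n ⧸ K) 0 (P.baseChange C (C_mem_gradingB 𝕜 n))
      (fun a : P.ι 0 => Ideal.quotientMap K C h (ε a)) := by
  have hq : ∀ (u : PolyA 𝕜 n) x,
      Ideal.quotientMap K C h (u • x) = (C u : PolyB 𝕜 n) • Ideal.quotientMap K C h x :=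
    fun u x => by
      obtain ⟨x, rfl⟩ := Ideal.Quotient.mk_surjective x
      exact congrArg (Ideal.Quotient.mk K) (map_mul C u x)
  refine ⟨⟨fun a => ?_, fun x => ?_, fun b => ?_, fun v hv => ?_, fun i v hv => ?_⟩,
    fun i a b => ?_⟩
  · obtain ⟨b, hb, hb'⟩ := hP.augmentation_degree a
    exact ⟨C b, C_mem_gradingB 𝕜 n _ b hb, congrArg (Ideal.quotientMap K C h) hb'⟩
  · obtain ⟨p, rfl⟩ := Ideal.Quotient.mk_surjective x
    -- As the module is cyclic, a preimage of `1` suffices: multiply it by `p`.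
    obtain ⟨u, hu⟩ := hP.augmentation_surjective 1
    refine ⟨fun a => p * C (u a), ?_⟩
    have h1 := congrArg (Ideal.quotientMap K C h) hu
    rw [map_sum, map_one] at h1
    simp only [hq] at h1
    simp only [mul_smul]
    refine (Finset.smul_sum (r := p)).symm.trans ((congrArg (p • ·) h1).trans ?_)
    change Ideal.Quotient.mk K (p * 1) = _
    rw [mul_one]
  · have h1 := congrArg (Ideal.quotientMap K C h) (hP.augmentation_comp b)
    rw [map_sum, map_zero] at h1
    simp only [hq] at h1
    exact h1
  · choose e he using fun a => Ideal.Quotient.mk_surjective (ε a)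
    have h1 : ∑ a, v a * C (e a) ∈ K := by
      rw [← Ideal.Quotient.eq_zero_iff_mem, map_sum, ← hv]
      refine Finset.sum_congr rfl fun a _ => ?_
      rw [← he a]
      rfl
    rw [hK, Ideal.mem_map_C_iff] at h1
    refine exists_mulVec_map_C (P.d 0) fun k => hP.exact_zero _ ?_
    have h2 := h1 k
    rw [Polynomial.finsetSum_coeff, ← Ideal.Quotient.eq_zero_iff_mem, map_sum] at h2
    simp only [Polynomial.coeff_mul_C] at h2
    rw [← h2]
    refine Finset.sum_congr rfl fun a _ => ?_
    rw [← he a]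
    rfl
  · refine exists_mulVec_map_C (P.d (i + 1)) fun k => hP.exact_succ i _ (funext fun a => ?_)
    exact (coeff_mulVec_map_C _ _ _ _).symm.trans
      ((congrArg (fun p => Polynomial.coeff p k) (congrFun hv a)).trans (Polynomial.coeff_zero k))
  · change resA 𝕜 n ((C (P.d i a b)).coeff 0) = 0
    rw [Polynomial.coeff_C_zero]
    exact hP.minimal i a b

theorem exists_isMinResA {I : Ideal (PolyA 𝕜 n)} (hI : IsProjClosed (ringProjA 𝕜 n) I) :
    ∃ (P : GradedFreeComplex (gradingA 𝕜 n)) (ε : P.ι 0 → PolyA 𝕜 n ⧸ I), IsMinResA I P ε :=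
  ((ringProjA 𝕜 n).cyclic (PolyA 𝕜 n ⧸ I) Ideal.Quotient.mk_surjective
    (by rwa [Ideal.Quotient.algebraMap_eq, Ideal.mk_ker]) 0).exists_minimal_resolution
    (isResidue_resA 𝕜 n) inferInstance

section Multiplication

variable {B : Type u} [CommRing B]

/-- Multiplication by `g`, as a map `B/I → B/K`. -/
def mulMap (I K : Ideal B) (g : B) (h : I ≤ K.colon {g}) : (B ⧸ I) →ₗ[B] (B ⧸ K) :=
  Submodule.mapQ I K (LinearMap.mulRight B g) fun x hx => by
    simpa [Submodule.mem_colon_singleton] using h hx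

theorem mulMap_mk {I K : Ideal B} {g : B} (h : I ≤ K.colon {g}) (b : B) :
    mulMap I K g h (Ideal.Quotient.mk I b) = Ideal.Quotient.mk K (b * g) :=
  rfl

end Multiplication

theorem IsProjClosed.sup {B : Type u} [CommRing B] {𝓑 : ℤ → AddSubgroup B} {P : RingProj 𝓑}
    {I K : Ideal B} (hI : IsProjClosed P I) (hK : IsProjClosed P K) : IsProjClosed P (I ⊔ K) := by
  intro q x hx
  obtain ⟨a, ha, b, hb, rfl⟩ := Submodule.mem_sup.mp hx
  rw [map_add]
  exact Submodule.add_mem_sup (hI q a ha) (hK q b hb)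

/-- Multiplication by `g = z g'` gives a minimal cone step if `(K : g) = I` and `I g' ⊆ K`. -/
theorem isConeStepB_of_colon {I K : Ideal (PolyB 𝕜 n)} {Q : Type u} [CommRing Q]
    [Algebra (PolyB 𝕜 n) Q] (hQ : Function.Surjective (algebraMap (PolyB 𝕜 n) Q))
    {g g' : PolyB 𝕜 n} {e : ℤ} (hg : g = X * g') (hg' : g' ∈ gradingB 𝕜 n (e - 1))
    (hI : K.colon {g} = I) (hI' : I ≤ K.colon {g'}) (hIc : IsProjClosed (ringProjB 𝕜 n) I)
    (hKc : IsProjClosed (ringProjB 𝕜 n) K)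
    (hker : RingHom.ker (algebraMap (PolyB 𝕜 n) Q) = K ⊔ Ideal.span {g}) :
    IsConeStepB (PolyB 𝕜 n ⧸ I) (PolyB 𝕜 n ⧸ K) Q e g := by
  have hge : g ∈ gradingB 𝕜 n e :=
    hg ▸ (ringProjB 𝕜 n).mul_mem X_mem_gradingB hg' (by omega)
  let φ := mulMap I K g hI.ge
  let ψ : (PolyB 𝕜 n ⧸ K) →ₐ[PolyB 𝕜 n] Q := Ideal.Quotient.liftₐ K (Algebra.ofId _ Q) fun a ha =>
    show a ∈ RingHom.ker (algebraMap (PolyB 𝕜 n) Q) from hker ▸ Ideal.mem_sup_left ha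
  have hψ : ∀ b, ψ (Ideal.Quotient.mk K b) = algebraMap _ Q b := fun b => rfl
  have hs : IsGradedShortExact (cyclicGrading (gradingB 𝕜 n) (PolyB 𝕜 n ⧸ I) e)
      (cyclicGrading (gradingB 𝕜 n) (PolyB 𝕜 n ⧸ K) 0) (cyclicGrading (gradingB 𝕜 n) Q 0) φ
      ψ.toLinearMap := by
    refine ⟨?_, ?_, ?_, ?_, fun x => ?_⟩
    · rintro q _ ⟨b, hb, rfl⟩
      exact ⟨b * g, (ringProjB 𝕜 n).mul_mem hb hge (by omega), rfl⟩
    · rintro q _ ⟨b, hb, rfl⟩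
      exact ⟨b, hb, rfl⟩
    · rw [← LinearMap.ker_eq_bot, LinearMap.ker_eq_bot']
      intro x hx
      obtain ⟨b, rfl⟩ := Ideal.Quotient.mk_surjective x
      rw [mulMap_mk, Ideal.Quotient.eq_zero_iff_mem] at hx
      rw [Ideal.Quotient.eq_zero_iff_mem, ← hI]
      exact Submodule.mem_colon_singleton.mpr hx
    · intro x
      obtain ⟨b, rfl⟩ := Ideal.Quotient.mk_surjective x
      have h1 : ψ.toLinearMap (Ideal.Quotient.mk K b) = 0 ↔ b ∈ K ⊔ Ideal.span {g} := by
        rw [← hker]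
        exact (RingHom.mem_ker (f := algebraMap (PolyB 𝕜 n) Q)).symm
      rw [h1, Submodule.mem_sup]
      constructor
      · rintro ⟨k, hk, y, hy, rfl⟩
        obtain ⟨c, rfl⟩ := Ideal.mem_span_singleton'.mp hy
        refine ⟨Ideal.Quotient.mk I c, ?_⟩
        rw [mulMap_mk, map_add, Ideal.Quotient.eq_zero_iff_mem.mpr hk, zero_add]
      · rintro ⟨y, hy⟩
        obtain ⟨c, rfl⟩ := Ideal.Quotient.mk_surjective y
        rw [mulMap_mk, Ideal.Quotient.eq] at hy
        exact ⟨b - c * g, by simpa using K.neg_mem hy, c * g,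
          Ideal.mem_span_singleton'.mpr ⟨c, rfl⟩, by ring⟩
    · obtain ⟨b, rfl⟩ := hQ x
      exact ⟨Ideal.Quotient.mk K b, rfl⟩
  let PI := (ringProjB 𝕜 n).cyclic (PolyB 𝕜 n ⧸ I) Ideal.Quotient.mk_surjective
    (by rwa [Ideal.Quotient.algebraMap_eq, Ideal.mk_ker]) e
  let PK := (ringProjB 𝕜 n).cyclic (PolyB 𝕜 n ⧸ K) Ideal.Quotient.mk_surjective
    (by rwa [Ideal.Quotient.algebraMap_eq, Ideal.mk_ker]) 0
  let PQ := (ringProjB 𝕜 n).cyclic Q hQ (hker ▸ hKc.sup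
    (isProjClosed_span _ fun x hx => ⟨e, Set.mem_singleton_iff.mp hx ▸ hge⟩)) 0
  -- The hypothesis `hI'` makes multiplication by `g'` well defined on `B/I`; it is the map of
  -- degree `-1` of which `φ` is the `z`-multiple.
  refine ⟨φ, ψ, ?_, hs.isMinimalConeStep (isResidue_resB 𝕜 n) PI PK PQ (φ' := mulMap I K g' hI')
    X_mem_gradingB (by simp) ?_ ?_
    (PI.exists_minimal_resolution (isResidue_resB 𝕜 n) inferInstance)
    (PK.exists_minimal_resolution (isResidue_resB 𝕜 n) inferInstance)⟩
  · change φ (Ideal.Quotient.mk I 1) = Ideal.Quotient.mk K g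
    rw [mulMap_mk, one_mul]
  · intro x
    obtain ⟨b, rfl⟩ := Ideal.Quotient.mk_surjective x
    change Ideal.Quotient.mk K (b * g) = Ideal.Quotient.mk K (X * (b * g'))
    rw [hg, mul_left_comm]
  · rintro q _ ⟨b, hb, rfl⟩
    exact ⟨b * g', (ringProjB 𝕜 n).mul_mem hb hg' (by omega), rfl⟩

/-- Linear maps between cyclic modules are determined by the image of the generator. -/
theorem quotient_linearMap_ext {B : Type u} [CommRing B] {I : Ideal B} {N : Type*}
    [AddCommGroup N] [Module B N] {φ φ' : (B ⧸ I) →ₗ[B] N} (h : φ 1 = φ' 1) : φ = φ' := by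
  ext
  exact h

theorem quotient_algHom_eq {B : Type u} [CommRing B] {I : Ideal B} {Q : Type*} [CommRing Q]
    [Algebra B Q] (ψ : (B ⧸ I) →ₐ[B] Q) (b : B) : ψ (Ideal.Quotient.mk I b) = algebraMap B Q b :=
  ψ.commutes b

/-- The mapping cone of a comparison map in a minimal cone step is a minimal resolution, for every
description of the maps of the step. -/
theorem IsConeStepB.cone_isMinResB {I K : Ideal (PolyB 𝕜 n)} {Q : Type u} [CommRing Q]
    [Algebra (PolyB 𝕜 n) Q] {g : PolyB 𝕜 n} {e : ℤ}
    (h : IsConeStepB (PolyB 𝕜 n ⧸ I) (PolyB 𝕜 n ⧸ K) Q e g)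
    {F G : GradedFreeComplex (gradingB 𝕜 n)} {εF : F.ι 0 → PolyB 𝕜 n ⧸ I}
    {εG : G.ι 0 → PolyB 𝕜 n ⧸ K} (hF : IsMinResB (PolyB 𝕜 n ⧸ I) e F εF)
    (hG : IsMinResB (PolyB 𝕜 n ⧸ K) 0 G εG) {Φ : F.Hom G} (hΦ : IsComparisonB g εF εG Φ)
    {ψ : PolyB 𝕜 n ⧸ K → Q} (hψ : ∀ b, ψ (Ideal.Quotient.mk K b) = algebraMap _ Q b) :
    IsMinResB Q 0 (cone Φ) (fun a : G.ι 0 => ψ (εG a)) := by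
  obtain ⟨φ, ψ', hφ, hstep⟩ := h
  obtain ⟨φ', hφ', hΦ⟩ := hΦ
  -- The comparison map and the cone step each come with their own linear map; both send `1` to the
  -- class of `g`, so they coincide.
  obtain rfl := quotient_linearMap_ext (hφ'.trans hφ.symm)
  have h1 : ψ = ψ' := funext fun x => by
    obtain ⟨b, rfl⟩ := Ideal.Quotient.mk_surjective x
    rw [hψ, quotient_algHom_eq]
  rw [h1]
  exact hstep.cone_minimal F G εF εG hF hG Φ hΦ

theorem IsConeStepB.exists_comparison {M N Q : Type u} [CommRing M] [Algebra (PolyB 𝕜 n) M]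
    [CommRing N] [Algebra (PolyB 𝕜 n) N] [CommRing Q]
    [Algebra (PolyB 𝕜 n) Q] {g : PolyB 𝕜 n} {e : ℤ} (h : IsConeStepB M N Q e g)
    {G : GradedFreeComplex (gradingB 𝕜 n)} {εG : G.ι 0 → N} (hG : IsMinResB N 0 G εG) :
    ∃ (F : GradedFreeComplex (gradingB 𝕜 n)) (εF : F.ι 0 → M) (Φ : F.Hom G),
      IsMinResB M e F εF ∧ IsComparisonB g εF εG Φ := by
  obtain ⟨φ, ψ, hφ, hstep⟩ := h
  obtain ⟨F, εF, hF⟩ := hstep.exists_left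
  obtain ⟨Φ, hΦ⟩ := hstep.exists_comparison F G εF εG hF hG
  exact ⟨F, εF, Φ, hF, φ, hφ, hΦ⟩

/-- Resolutions can be transported along an isomorphism of cyclic modules. -/
theorem IsMinResB.of_ker_eq {K : Ideal (PolyB 𝕜 n)} {Q : Type u} [CommRing Q]
    [Algebra (PolyB 𝕜 n) Q] (hQ : Function.Surjective (algebraMap (PolyB 𝕜 n) Q))
    (hker : RingHom.ker (algebraMap (PolyB 𝕜 n) Q) = K)
    {G : GradedFreeComplex (gradingB 𝕜 n)} {εG : G.ι 0 → PolyB 𝕜 n ⧸ K}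
    (hG : IsMinResB (PolyB 𝕜 n ⧸ K) 0 G εG) (ψ : (PolyB 𝕜 n ⧸ K) →ₐ[PolyB 𝕜 n] Q) :
    IsMinResB Q 0 G (fun a => ψ (εG a)) := by
  have hψ : ∀ v : G.ι 0 → PolyB 𝕜 n, ∑ a, v a • ψ (εG a) = ψ (∑ a, v a • εG a) := fun v => by
    simp only [map_sum, map_smul]
  refine ⟨⟨fun a => ?_, fun x => ?_, fun b => ?_, fun v hv => hG.exact_zero v ?_, hG.exact_succ⟩,
    hG.minimal⟩
  · obtain ⟨b, hb, hb'⟩ := hG.augmentation_degree a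
    exact ⟨b, hb, (ψ.commutes b).symm.trans (congrArg ψ hb')⟩
  · obtain ⟨b, rfl⟩ := hQ x
    obtain ⟨v, hv⟩ := hG.augmentation_surjective (Ideal.Quotient.mk K b)
    exact ⟨v, by rw [hψ, hv, quotient_algHom_eq]⟩
  · rw [hψ, hG.augmentation_comp, map_zero]
  · rw [hψ] at hv
    obtain ⟨b, hb⟩ := Ideal.Quotient.mk_surjective (∑ a, v a • εG a)
    rw [← hb, quotient_algHom_eq, ← RingHom.mem_ker, hker] at hv
    rw [← hb, Ideal.Quotient.eq_zero_iff_mem.mpr hv]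

end Steps

/-! ### Coefficient ideals, colon ideals and the iterated cone of a `z`-stable ideal. -/

section Ideals

universe u

open Polynomial (C X)

variable {𝕜 : Type u} [Field 𝕜] {n : ℕ}

theorem isProjClosed_map_C {I : Ideal (PolyA 𝕜 n)} (hI : IsProjClosed (ringProjA 𝕜 n) I) :
    IsProjClosed (ringProjB 𝕜 n) (I.map C) := fun q x hx => by
  rw [Ideal.mem_map_C_iff] at hx ⊢
  intro i
  exact (coeff_projB q x i).symm ▸ hI _ _ (hx i)

theorem mem_of_forall_coeff {I : Ideal (PolyB 𝕜 n)} {p : PolyB 𝕜 n}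
    (h : ∀ i, C (p.coeff i) * X ^ i ∈ I) : p ∈ I := by
  rw [p.as_sum_support_C_mul_X_pow]
  exact Ideal.sum_mem _ fun i _ => h i

theorem mem_of_forall_homogeneousComponent {I : Ideal (PolyB 𝕜 n)} {a : PolyA 𝕜 n} {i : ℕ}
    (h : ∀ d, C (MvPolynomial.homogeneousComponent d a) * X ^ i ∈ I) : C a * X ^ i ∈ I := by
  rw [← MvPolynomial.sum_homogeneousComponent a, map_sum, Finset.sum_mul]
  exact Ideal.sum_mem _ fun d _ => h d

section Maximal

theorem isProjClosed_maxA : IsProjClosed (ringProjA 𝕜 n) (maxA 𝕜 n) :=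
  isProjClosed_span _ fun x ⟨_, hl⟩ =>
    ⟨(1 : ℕ), (gradingA_natCast 𝕜 n 1 x).mpr (hl ▸ MvPolynomial.isHomogeneous_X _ _)⟩

theorem mem_maxA_of_constantCoeff_eq_zero {a : PolyA 𝕜 n}
    (ha : MvPolynomial.constantCoeff a = 0) : a ∈ maxA 𝕜 n := by
  rw [maxA, ← Set.image_univ, MvPolynomial.mem_ideal_span_X_image]
  intro m hm
  by_contra h
  push Not at h
  obtain rfl : m = 0 := Finsupp.ext fun l => h l (Set.mem_univ l)
  exact MvPolynomial.mem_support_iff.mp hm ha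

end Maximal

section Monomial

variable {m : ℕ} {f : Fin m → PolyA 𝕜 n} {d j : Fin m → ℕ}

/-- The coefficient ideal at `z^i` of the ideal generated by the `f_l z^{j_l}` with `l ∈ L`. -/
noncomputable def levelIdeal (f : Fin m → PolyA 𝕜 n) (j : Fin m → ℕ) (L : Set (Fin m)) (i : ℕ) :
    Ideal (PolyA 𝕜 n) :=
  Ideal.span (f '' {l | l ∈ L ∧ j l ≤ i})

theorem levelIdeal_mono (L : Set (Fin m)) {i k : ℕ} (h : i ≤ k) :
    levelIdeal f j L i ≤ levelIdeal f j L k :=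
  Ideal.span_mono (Set.image_mono fun _ hl => ⟨hl.1, hl.2.trans h⟩)

/-- The generator `f_l z^{j_l}` contributes `f_l` to every level `i ≥ j_l`, by multiplication with
powers of `z`. The levels increase with `i`, so the coefficientwise condition defines an ideal.
Membership in `B` thus becomes membership in ideals of `A`. -/
theorem mem_span_monomials {L : Set (Fin m)} {p : PolyB 𝕜 n} :
    p ∈ Ideal.span ((fun l => (C (f l) * X ^ j l : PolyB 𝕜 n)) '' L) ↔
      ∀ i, p.coeff i ∈ levelIdeal f j L i := by
  constructor
  · intro hp
    induction hp using Submodule.span_induction with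
    | mem x hx =>
      obtain ⟨l, hl, rfl⟩ := hx
      intro i
      rw [Polynomial.coeff_C_mul_X_pow]
      split_ifs with h
      · exact Ideal.subset_span ⟨l, ⟨hl, h.ge⟩, rfl⟩
      · exact Ideal.zero_mem _
    | zero => simp
    | add x y _ _ hx hy =>
      intro i
      rw [Polynomial.coeff_add]
      exact Ideal.add_mem _ (hx i) (hy i)
    | smul a x _ hx =>
      intro i
      rw [smul_eq_mul, Polynomial.coeff_mul]
      refine Ideal.sum_mem _ fun x hx' => Ideal.mul_mem_left _ _ (levelIdeal_mono L ?_ (hx x.2))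
      have := Finset.HasAntidiagonal.mem_antidiagonal.mp hx'
      omega
  · refine fun hp => mem_of_forall_coeff fun i => ?_
    have h1 : levelIdeal f j L i ≤ Submodule.comap (C : PolyA 𝕜 n →+* PolyB 𝕜 n).toSemilinearMap
        ((Ideal.span ((fun l => (C (f l) * X ^ j l : PolyB 𝕜 n)) '' L)).colon {X ^ i}) := by
      refine Submodule.span_le.mpr ?_
      rintro _ ⟨l, ⟨hl, hli⟩, rfl⟩
      refine Submodule.mem_colon_singleton.mpr ?_
      have h2 : (C (f l) * X ^ i : PolyB 𝕜 n) = X ^ (i - j l) * (C (f l) * X ^ j l) := by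
        rw [mul_left_comm, ← pow_add, Nat.sub_add_cancel hli]
      change C (f l) * X ^ i ∈ _
      rw [h2]
      exact Ideal.mul_mem_left _ _ (Ideal.subset_span ⟨l, hl, rfl⟩)
    exact Submodule.mem_colon_singleton.mp (h1 (hp i))

theorem C_mul_X_pow_mem_span_monomials {L : Set (Fin m)} {a : PolyA 𝕜 n} {i : ℕ} :
    C a * X ^ i ∈ Ideal.span ((fun l => (C (f l) * X ^ j l : PolyB 𝕜 n)) '' L) ↔
      a ∈ levelIdeal f j L i := by
  rw [mem_span_monomials]
  refine ⟨fun h => by simpa using h i, fun h k => ?_⟩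
  rw [Polynomial.coeff_C_mul_X_pow]
  split_ifs with hk
  · exact hk ▸ h
  · exact Ideal.zero_mem _

theorem partialIdeal_eq (s : ℕ) : partialIdeal f j s =
    Ideal.span ((fun l => (C (f l) * X ^ j l : PolyB 𝕜 n)) '' {l | (l : ℕ) < s}) := by
  rw [partialIdeal]
  congr 1
  ext p
  exact exists_congr fun l => and_congr_right fun _ => eq_comm

theorem partialIdeal_succ (l : Fin m) : partialIdeal f j (l + 1) =
    partialIdeal f j l ⊔ Ideal.span {C (f l) * X ^ j l} := by
  rw [partialIdeal_eq, partialIdeal_eq, ← Ideal.span_union]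
  congr 1
  have h1 : {k : Fin m | (k : ℕ) < l + 1} = {k : Fin m | (k : ℕ) < l} ∪ {l} := by
    ext k
    simp only [Set.mem_ofPred_eq, Set.mem_union, Set.mem_singleton_iff, Fin.ext_iff]
    omega
  rw [h1, Set.image_union, Set.image_singleton]

theorem isProjClosed_partialIdeal (hf : ∀ l, (f l).IsHomogeneous (d l)) (s : ℕ) :
    IsProjClosed (ringProjB 𝕜 n) (partialIdeal f j s) :=
  isProjClosed_span _ fun _ ⟨l, _, hl⟩ => ⟨d l + j l, hl ▸ C_mul_X_pow_mem_gradingB (hf l) rfl⟩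

/-- As `j` is monotone, its zeros form an initial segment of the indices, so their number is the
cutoff. -/
theorem lt_numZero_iff (hj : Monotone j) (l : Fin m) : (l : ℕ) < numZero j ↔ j l = 0 := by
  constructor
  · intro h
    by_contra h0
    refine absurd h (not_lt.mpr ?_)
    rw [numZero, ← Fin.card_Iio l]
    refine Finset.card_le_card fun k hk => ?_
    rw [Finset.mem_Iio]
    by_contra hkl
    have h1 := hj (not_lt.mp hkl)
    have h2 := (Finset.mem_filter.mp hk).2
    omega
  · intro h
    have h1 : (Finset.Iic l).card ≤ numZero j := Finset.card_le_card fun k hk => by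
      have h1 := hj (Finset.mem_Iic.mp hk)
      exact Finset.mem_filter.mpr ⟨Finset.mem_univ k, by omega⟩
    rw [Fin.card_Iic] at h1
    omega

theorem numZero_le (j : Fin m → ℕ) : numZero j ≤ m :=
  (Finset.card_filter_le _ _).trans_eq (Finset.card_fin m)

end Monomial

/-! ### The levels of a `z`-stable ideal and the ideal `J'`. -/

section Stable

variable {𝔞 : Ideal (PolyA 𝕜 n)} {t : ℕ∞} {J : Ideal (RingS 𝔞 t)}

theorem algebraMap_quotient_surjective (J : Ideal (RingS 𝔞 t)) :
    Function.Surjective (algebraMap (PolyB 𝕜 n) (RingS 𝔞 t ⧸ J)) :=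
  Ideal.Quotient.mk_surjective.comp (Ideal.Quotient.mk_surjective)

theorem ker_algebraMap_quotient (J : Ideal (RingS 𝔞 t)) :
    RingHom.ker (algebraMap (PolyB 𝕜 n) (RingS 𝔞 t ⧸ J)) = preimage J := by
  ext p
  exact Ideal.Quotient.eq_zero_iff_mem

theorem X_pow_mem_preimage (J : Ideal (RingS 𝔞 t)) {T : ℕ} (hT : t = T) :
    X ^ T ∈ preimage J := by
  have h1 : toS 𝔞 t (X ^ T) = 0 :=
    Ideal.Quotient.eq_zero_iff_mem.mpr (Ideal.mem_sup_right (Ideal.subset_span ⟨T, hT, rfl⟩))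
  change toS 𝔞 t (X ^ T) ∈ J
  rw [h1]
  exact J.zero_mem

theorem mem_compA_of_lt {i : ℕ} (hi : (i : ℕ∞) < t) {a : PolyA 𝕜 n} :
    a ∈ compA J i ↔ C a * X ^ i ∈ preimage J := by
  rw [compA, if_pos hi]
  exact Submodule.mem_colon_singleton

/-- The constant range begins at `T - 1`, not at `T`; this is why the bound is `T ≤ i + 1`. -/
theorem compA_of_le {T : ℕ} (hT : t = T) (hT0 : 0 < T) {i : ℕ} (hi : T ≤ i + 1) :
    compA J i = compA J (T - 1) := by
  subst hT
  rcases hi.eq_or_lt with h | h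
  · obtain rfl : i = T - 1 := by omega
    rfl
  · rw [compA, compA, if_neg (by exact_mod_cast (by omega : ¬ i < T)),
      if_pos (by exact_mod_cast (by omega : T - 1 < T)), ENat.toNat_natCast]

theorem compA_mono (J : Ideal (RingS 𝔞 t)) : Monotone (compA J) :=
  monotone_nat_of_le_succ (compA_le_succ J)

/-- Reduces statements about all levels to those below `t`, where `compA` is the colon ideal by
`z^i` itself. -/
theorem exists_lt_compA_eq (ht : 0 < t) (J : Ideal (RingS 𝔞 t)) (i : ℕ) :
    ∃ k ≤ i, (k : ℕ∞) < t ∧ compA J i = compA J k := by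
  by_cases hi : (i : ℕ∞) < t
  · exact ⟨i, le_rfl, hi, rfl⟩
  · have h1 : t ≠ ⊤ := fun h => hi (h ▸ ENat.natCast_lt_top i)
    obtain ⟨T, hT⟩ := ENat.ne_top_iff_exists.mp h1
    have h2 : 0 < T := by
      rw [← hT] at ht
      exact_mod_cast ht
    have h3 : T ≤ i := by
      rw [← hT] at hi
      exact_mod_cast not_lt.mp hi
    refine ⟨T - 1, by omega, ?_, compA_of_le hT.symm h2 (by omega)⟩
    rw [← hT]
    exact_mod_cast (by omega : T - 1 < T)

theorem isProjClosed_compA (ht : 0 < t) (hJ : IsMultigraded J) (i : ℕ) :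
    IsProjClosed (ringProjA 𝕜 n) (compA J i) := fun q a ha => by
  obtain ⟨k, -, hk, h⟩ := exists_lt_compA_eq ht J i
  rw [h, mem_compA_of_lt hk] at ha ⊢
  change C (projA 𝕜 n q a) * X ^ k ∈ preimage J
  obtain hq | hq := lt_or_ge q 0
  · rw [projA_neg hq, map_zero, zero_mul]
    exact Ideal.zero_mem _
  · lift q to ℕ using hq
    rw [projA_natCast]
    have h1 := hJ _ ha q k
    rwa [Polynomial.coeff_C_mul_X_pow, if_pos rfl] at h1

theorem isProjClosed_primeIdeal (ht : 0 < t) (hJ : IsMultigraded J) :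
    IsProjClosed (ringProjB 𝕜 n) (primeIdeal J) := fun q p hp i =>
  (coeff_projB q p i).symm ▸ isProjClosed_compA ht hJ i _ _ (hp i)

/-- Multigradedness separates the powers of `z`, and coefficients at powers `≥ t` are unrestricted
because `z^t` lies in the preimage. -/
theorem mem_preimage_iff (hJ : IsMultigraded J) {p : PolyB 𝕜 n} :
    p ∈ preimage J ↔ ∀ i : ℕ, (i : ℕ∞) < t → p.coeff i ∈ compA J i := by
  constructor
  · intro hp i hi
    rw [mem_compA_of_lt hi]
    exact mem_of_forall_homogeneousComponent fun d => hJ p hp d i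
  · intro h
    refine mem_of_forall_coeff fun i => ?_
    by_cases hi : (i : ℕ∞) < t
    · exact (mem_compA_of_lt hi).mp (h i hi)
    · have h1 : t ≠ ⊤ := fun h => hi (h ▸ ENat.natCast_lt_top i)
      obtain ⟨T, hT⟩ := ENat.ne_top_iff_exists.mp h1
      have h3 : T ≤ i := by
        rw [← hT] at hi
        exact_mod_cast not_lt.mp hi
      rw [← Nat.sub_add_cancel h3, pow_add, ← mul_assoc]
      exact Ideal.mul_mem_left _ _ (X_pow_mem_preimage J hT.symm)

/-- Stability extends to every `i > 0`: for `i ≥ t`, level `i` equals an earlier one and is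
therefore contained in level `i - 1`. -/
theorem mul_mem_compA_pred (ht : 0 < t) (hJ : IsZStable J) {i : ℕ} (hi : 0 < i) {a b : PolyA 𝕜 n}
    (ha : a ∈ maxA 𝕜 n) (hb : b ∈ compA J i) : a * b ∈ compA J (i - 1) := by
  by_cases hit : (i : ℕ∞) < t
  · have h1 : ∀ (k : ℕ) c, (k : ℕ∞) < t → (Ideal.Quotient.mk 𝔞 c ∈ compR J k ↔ c ∈ compA J k) :=
      fun k c hk => by
        rw [mem_compA_of_lt hk, compR, Ideal.mem_comap, Submodule.mem_colon_singleton]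
        change toS 𝔞 t (C c) * toS 𝔞 t (X ^ k) ∈ J ↔ toS 𝔞 t (C c * X ^ k) ∈ J
        rw [map_mul]
    rw [← h1 _ _ ((Nat.cast_le.mpr (Nat.sub_le i 1)).trans_lt hit), map_mul]
    exact hJ.stable i hi hit (Ideal.mul_mem_mul (Ideal.mem_map_of_mem _ ha) ((h1 _ _ hit).mpr hb))
  · obtain ⟨k, hk, hkt, h⟩ := exists_lt_compA_eq ht J i
    have h2 : k ≠ i := fun h => hit (h ▸ hkt)
    rw [h] at hb
    exact Ideal.mul_mem_left _ _ (compA_mono J (by omega) hb)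

theorem C_mul_X_pow_mem_primeIdeal {a : PolyA 𝕜 n} {i : ℕ} :
    C a * X ^ i ∈ primeIdeal J ↔ a ∈ compA J i := by
  refine ⟨fun h => by simpa using h i, fun h k => ?_⟩
  rw [Polynomial.coeff_C_mul_X_pow]
  split_ifs with hk
  · exact hk ▸ h
  · exact Ideal.zero_mem _

theorem primeIdeal_eq_preimage (hJ : IsMultigraded J) (ht : t = ⊤) :
    primeIdeal J = preimage J := by
  ext p
  rw [mem_preimage_iff hJ]
  exact forall_congr' fun i => ⟨fun h _ => h, fun h => h (ht ▸ ENat.natCast_lt_top i)⟩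

theorem preimage_eq_sup (hJ : IsMultigraded J) {T : ℕ} (ht : t = T) :
    preimage J = primeIdeal J ⊔ Ideal.span {X ^ T} := by
  apply le_antisymm
  · refine fun p hp => mem_of_forall_coeff fun i => ?_
    by_cases hi : i < T
    · exact Ideal.mem_sup_left (C_mul_X_pow_mem_primeIdeal.mpr
        ((mem_preimage_iff hJ).mp hp i (by rw [ht]; exact_mod_cast hi)))
    · rw [← Nat.sub_add_cancel (not_lt.mp hi), pow_add, ← mul_assoc]
      exact Ideal.mem_sup_right (Ideal.mul_mem_left _ _ (Ideal.mem_span_singleton_self _))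
  · refine sup_le (fun p hp => (mem_preimage_iff hJ).mpr fun i _ => hp i) ?_
    rw [Ideal.span_singleton_le_iff_mem]
    exact X_pow_mem_preimage J ht

/-- Multiplication by `z^T` moves every coefficient into the range where the levels have become
constant. -/
theorem primeIdeal_colon_X_pow {T : ℕ} (ht : t = T) (hT : 0 < T) :
    (primeIdeal J).colon {(X ^ T : PolyB 𝕜 n)} = (compA J (T - 1)).map C := by
  ext p
  rw [Submodule.mem_colon_singleton, Ideal.mem_map_C_iff, smul_eq_mul]
  constructor
  · intro h i
    have h1 := h (i + T)
    rwa [Polynomial.coeff_mul_X_pow, compA_of_le ht hT (by omega)] at h1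
  · intro h i
    rw [Polynomial.coeff_mul_X_pow']
    split_ifs with hi
    · exact compA_mono J (by omega) (h _)
    · exact Ideal.zero_mem _

/-- Multigradedness makes `J'` spanned by its bihomogeneous elements. A finite irredundant family of
these is then sorted by the exponent of `z`. -/
theorem exists_isOrderedMinGens (ht : 0 < t) (hJ : IsMultigraded J) :
    ∃ (m : ℕ) (f : Fin m → PolyA 𝕜 n) (d j : Fin m → ℕ),
      IsOrderedMinGens (primeIdeal J) f d j := by
  let 𝓗 : Set (PolyB 𝕜 n) := {p | p ∈ primeIdeal J ∧ ∃ (f : PolyA 𝕜 n) (d j : ℕ),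
    f.IsHomogeneous d ∧ C f * X ^ j = p}
  have hspan : Ideal.span 𝓗 = primeIdeal J := by
    refine le_antisymm (Ideal.span_le.mpr fun p hp => hp.1) fun p hp => ?_
    refine mem_of_forall_coeff fun i => mem_of_forall_homogeneousComponent fun d => ?_
    refine Ideal.subset_span ⟨C_mul_X_pow_mem_primeIdeal.mpr ?_, _, d, i,
      MvPolynomial.homogeneousComponent_isHomogeneous d _, rfl⟩
    rw [← projA_natCast]
    exact isProjClosed_compA ht hJ i _ _ (hp i)
  obtain ⟨m, g, hg, hg', hi⟩ := exists_irredundant_family (B := PolyB 𝕜 n) 𝓗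
    (IsNoetherian.noetherian _)
  choose f d j hf hfg using fun a => (hg a).2
  let σ := Tuple.sort j
  have hσ : (fun l => (C (f (σ l)) * X ^ j (σ l) : PolyB 𝕜 n)) = g ∘ σ :=
    funext fun l => hfg (σ l)
  refine ⟨m, f ∘ σ, d ∘ σ, j ∘ σ, ⟨fun l => hf (σ l), Tuple.monotone_sort j, ?_, fun l => ?_⟩⟩
  · change Ideal.span (Set.range fun l => (C (f (σ l)) * X ^ j (σ l) : PolyB 𝕜 n)) = _
    rw [hσ, σ.surjective.range_comp]
    exact hg'.trans hspan
  · change (C (f (σ l)) * X ^ j (σ l) : PolyB 𝕜 n) ∉ Ideal.span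
      ((fun l => (C (f (σ l)) * X ^ j (σ l) : PolyB 𝕜 n)) '' _)
    rw [hσ, hfg]
    refine fun h => hi (σ l) (Submodule.span_mono ?_ h)
    rintro _ ⟨k, hk, rfl⟩
    exact ⟨σ k, fun h => hk (σ.injective h), rfl⟩

/-! ### Colon ideals by successive generators, and the cone tower. -/

section Generators

variable {m : ℕ} {f : Fin m → PolyA 𝕜 n} {d j : Fin m → ℕ}

theorem IsOrderedMinGens.compA_eq (h : IsOrderedMinGens (primeIdeal J) f d j) (i : ℕ) :
    compA J i = levelIdeal f j Set.univ i := by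
  ext a
  rw [← C_mul_X_pow_mem_primeIdeal, ← h.span_eq, ← Set.image_univ, C_mul_X_pow_mem_span_monomials]

/-- Generators of `z`-degree zero contribute equally to all levels, so every level of the ideal they
generate is `J_⟨0⟩`. -/
theorem IsOrderedMinGens.partialIdeal_numZero (h : IsOrderedMinGens (primeIdeal J) f d j) :
    partialIdeal f j (numZero j) = (compA J 0).map C := by
  ext p
  rw [partialIdeal_eq, mem_span_monomials, Ideal.mem_map_C_iff, h.compA_eq]
  refine forall_congr' fun i => ?_
  have h1 : {l : Fin m | l ∈ {l : Fin m | (l : ℕ) < numZero j} ∧ j l ≤ i} =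
      {l | l ∈ Set.univ ∧ j l ≤ 0} := by
    ext l
    simp only [Set.mem_ofPred_eq, lt_numZero_iff h.ordered, Set.mem_univ, true_and]
    omega
  rw [levelIdeal, levelIdeal, h1]

theorem IsOrderedMinGens.partialIdeal_card (h : IsOrderedMinGens (primeIdeal J) f d j) :
    partialIdeal f j m = primeIdeal J := by
  rw [partialIdeal_eq, ← h.span_eq, ← Set.image_univ]
  congr 2
  ext l
  simp

/-- By `z`-stability `a * f l` lies in level `j l - 1` of `J'`. The generators contributing to that
level have smaller exponent than `f l`, hence precede it in the order. -/
theorem IsOrderedMinGens.mul_mem_levelIdeal (ht : 0 < t) (hJ : IsZStable J)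
    (h : IsOrderedMinGens (primeIdeal J) f d j) {l : Fin m} (hl : 0 < j l) {a : PolyA 𝕜 n}
    (ha : a ∈ maxA 𝕜 n) : a * f l ∈ levelIdeal f j {k | (k : ℕ) < l} (j l - 1) := by
  have h1 : f l ∈ compA J (j l) := by
    rw [← C_mul_X_pow_mem_primeIdeal, ← h.span_eq]
    exact Ideal.subset_span ⟨l, rfl⟩
  have h2 := mul_mem_compA_pred ht hJ hl ha h1
  rw [h.compA_eq] at h2
  refine Ideal.span_mono (Set.image_mono ?_) h2
  intro k hk
  refine ⟨?_, hk.2⟩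
  by_contra hkl
  have h3 := h.ordered (not_lt.mp hkl)
  have h4 := hk.2
  omega

/-- If `a` had constant term `c ≠ 0`, then `(a - c) f_l` would lie in the ideal of the preceding
generators by `z`-stability, hence so would `c f_l`. This contradicts irredundancy. -/
theorem IsOrderedMinGens.mem_maxA (ht : 0 < t) (hJ : IsZStable J)
    (h : IsOrderedMinGens (primeIdeal J) f d j) {l : Fin m} (hl : 0 < j l) {a : PolyA 𝕜 n} {i : ℕ}
    (ha : a * f l ∈ levelIdeal f j {k | (k : ℕ) < l} i) : a ∈ maxA 𝕜 n := by
  refine mem_maxA_of_constantCoeff_eq_zero ?_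
  by_contra hc
  set c := MvPolynomial.constantCoeff a with hca
  have h1 : a - MvPolynomial.C c ∈ maxA 𝕜 n :=
    mem_maxA_of_constantCoeff_eq_zero (by simp [hca])
  -- Level `i` may be replaced by level `j l`, since all preceding generators have exponent at most
  -- `j l`.
  have h2 : a * f l ∈ levelIdeal f j {k | (k : ℕ) < l} (j l) :=
    Ideal.span_mono (Set.image_mono (fun k hk => ⟨hk.1, h.ordered (le_of_lt hk.1)⟩ :
      {k : Fin m | k ∈ {k : Fin m | (k : ℕ) < l} ∧ j k ≤ i} ⊆ {k | _ ∧ j k ≤ j l})) ha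
  have h3 := levelIdeal_mono _ (Nat.sub_le (j l) 1) (h.mul_mem_levelIdeal ht hJ hl h1)
  have h4 := Ideal.mul_mem_left _ (MvPolynomial.C c⁻¹) (Ideal.sub_mem _ h2 h3)
  have h5 : MvPolynomial.C c⁻¹ * (a * f l - (a - MvPolynomial.C c) * f l) = f l := by
    rw [← sub_mul, sub_sub_cancel, ← mul_assoc, ← MvPolynomial.C_mul, inv_mul_cancel₀ hc,
      MvPolynomial.C_1, one_mul]
  rw [h5] at h4
  refine h.irredundant l (Ideal.span_mono (Set.image_mono fun k hk => ?_)
    (C_mul_X_pow_mem_span_monomials.mpr h4))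
  exact fun hkl => absurd (congrArg Fin.val hkl) (ne_of_lt hk)

/-- The exponent is one smaller than in the generator. This spare factor `z` is what makes the cone
minimal. -/
theorem IsOrderedMinGens.map_maxA_le_colon (ht : 0 < t) (hJ : IsZStable J)
    (h : IsOrderedMinGens (primeIdeal J) f d j) {l : Fin m} (hl : 0 < j l) :
    (maxA 𝕜 n).map C ≤ (partialIdeal f j l).colon {C (f l) * X ^ (j l - 1)} := by
  rw [Ideal.map_le_iff_le_comap]
  intro a ha
  rw [Ideal.mem_comap, Submodule.mem_colon_singleton, smul_eq_mul, ← mul_assoc, ← Polynomial.C_mul,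
    partialIdeal_eq, C_mul_X_pow_mem_span_monomials]
  exact h.mul_mem_levelIdeal ht hJ hl ha

theorem C_mul_X_pow_eq {a : PolyA 𝕜 n} {i : ℕ} (hi : 0 < i) :
    (C a * X ^ i : PolyB 𝕜 n) = X * (C a * X ^ (i - 1)) := by
  rw [mul_left_comm, ← pow_succ', Nat.sub_add_cancel hi]

theorem IsOrderedMinGens.colon_eq (ht : 0 < t) (hJ : IsZStable J)
    (h : IsOrderedMinGens (primeIdeal J) f d j) {l : Fin m} (hl : 0 < j l) :
    (partialIdeal f j l).colon {C (f l) * X ^ j l} = (maxA 𝕜 n).map C := by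
  apply le_antisymm
  · intro p hp
    rw [Submodule.mem_colon_singleton, smul_eq_mul, partialIdeal_eq, mem_span_monomials] at hp
    rw [Ideal.mem_map_C_iff]
    intro i
    have h1 := hp (i + j l)
    rw [← mul_assoc, Polynomial.coeff_mul_X_pow, Polynomial.coeff_mul_C] at h1
    exact h.mem_maxA ht hJ hl h1
  · intro p hp
    have h1 := Submodule.mem_colon_singleton.mp (h.map_maxA_le_colon ht hJ hl hp)
    rw [Submodule.mem_colon_singleton, C_mul_X_pow_eq hl, smul_eq_mul, mul_left_comm]
    exact Ideal.mul_mem_left _ _ h1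

theorem IsOrderedMinGens.isConeStepB (ht : 0 < t) (hJ : IsZStable J)
    (h : IsOrderedMinGens (primeIdeal J) f d j) {l : Fin m} (hl : 0 < j l) :
    IsConeStepB (𝕜 := 𝕜) (n := n) (ModMaxA 𝕜 n) (PolyB 𝕜 n ⧸ partialIdeal f j l)
      (PolyB 𝕜 n ⧸ partialIdeal f j (l + 1)) (d l + j l) (C (f l) * X ^ j l) :=
by
  have hQ : Function.Surjective
      (algebraMap (PolyB 𝕜 n) (PolyB 𝕜 n ⧸ partialIdeal f j (l + 1))) :=
    Ideal.Quotient.mk_surjective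
  have hker : RingHom.ker (algebraMap (PolyB 𝕜 n) (PolyB 𝕜 n ⧸ partialIdeal f j (l + 1))) =
      partialIdeal f j l ⊔ Ideal.span {C (f l) * X ^ j l} := by
    rw [Ideal.Quotient.algebraMap_eq, Ideal.mk_ker, partialIdeal_succ]
  have hg : (C (f l) * X ^ (j l - 1) : PolyB 𝕜 n) ∈ gradingB 𝕜 n ((d l + j l : ℤ) - 1) :=
    C_mul_X_pow_mem_gradingB (h.homogeneous l) (by omega)
  exact isConeStepB_of_colon hQ (C_mul_X_pow_eq hl) hg (h.colon_eq ht hJ hl)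
    (h.map_maxA_le_colon ht hJ hl) (isProjClosed_map_C isProjClosed_maxA)
    (isProjClosed_partialIdeal h.homogeneous l) hker

theorem isConeStepB_X_pow (ht : 0 < t) (hJ : IsMultigraded J) {T : ℕ} (hT : t = T) :
    IsConeStepB (𝕜 := 𝕜) (n := n) (PolyB 𝕜 n ⧸ (compA J (T - 1)).map C)
      (PolyB 𝕜 n ⧸ primeIdeal J) (RingS 𝔞 t ⧸ J) T (X ^ T) := by
  have hT0 : 0 < T := by
    rw [hT] at ht
    exact_mod_cast ht
  refine isConeStepB_of_colon (algebraMap_quotient_surjective J)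
    (mul_pow_sub_one hT0.ne' X).symm ?_ (primeIdeal_colon_X_pow hT hT0) ?_
    (isProjClosed_map_C (isProjClosed_compA ht hJ _)) (isProjClosed_primeIdeal ht hJ)
    (by rw [ker_algebraMap_quotient, preimage_eq_sup hJ hT])
  · have h1 := C_mul_X_pow_mem_gradingB (𝕜 := 𝕜) (n := n) (MvPolynomial.isHomogeneous_one _ _)
      (j := T - 1) (q := T - 1) (by omega)
    rwa [map_one, one_mul] at h1
  · rw [Ideal.map_le_iff_le_comap]
    intro a ha
    rw [Ideal.mem_comap, Submodule.mem_colon_singleton, smul_eq_mul]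
    exact C_mul_X_pow_mem_primeIdeal.mpr ha

theorem IsOrderedMinGens.coneTower_isMinResB (ht : 0 < t) (hJ : IsZStable J)
    (h : IsOrderedMinGens (primeIdeal J) f d j) {s : ℕ} {G : GradedFreeComplex (gradingB 𝕜 n)}
    {ε : G.ι 0 → PolyB 𝕜 n ⧸ partialIdeal f j s} (hG : ConeTower (compA J 0) f d j s G ε) :
    IsMinResB (PolyB 𝕜 n ⧸ partialIdeal f j s) 0 G ε := by
  induction hG with
  | base P ε hP hle => exact hP.baseChange h.partialIdeal_numZero hle
  | step l hl G εG hG F εF hF Φ hΦ ih =>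
    exact (h.isConeStepB ht hJ hl).cone_isMinResB hF ih hΦ fun b => rfl

theorem IsOrderedMinGens.exists_coneTower (ht : 0 < t) (hJ : IsZStable J)
    (h : IsOrderedMinGens (primeIdeal J) f d j) {s : ℕ} (hs : numZero j ≤ s) (hsm : s ≤ m) :
    ∃ (G : GradedFreeComplex (gradingB 𝕜 n)) (ε : G.ι 0 → PolyB 𝕜 n ⧸ partialIdeal f j s),
      ConeTower (compA J 0) f d j s G ε := by
  induction s, hs using Nat.le_induction with
  | base =>
    obtain ⟨P, ε, hP⟩ := exists_isMinResA (isProjClosed_compA ht hJ.multigraded 0)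
    exact ⟨_, _, ConeTower.base P ε hP
      (Ideal.map_le_iff_le_comap.mp h.partialIdeal_numZero.ge)⟩
  | succ s hs ih =>
    obtain ⟨G, εG, hG⟩ := ih (Nat.le_of_succ_le hsm)
    let l : Fin m := ⟨s, hsm⟩
    -- The index `s` is past all generators of `z`-degree zero.
    have hl : 0 < j l := Nat.pos_of_ne_zero fun h0 =>
      absurd ((lt_numZero_iff h.ordered l).mpr h0) (not_lt.mpr hs)
    obtain ⟨F, εF, Φ, hF, hΦ⟩ :=
      (h.isConeStepB ht hJ hl).exists_comparison (h.coneTower_isMinResB ht hJ hG)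
    exact ⟨_, _, ConeTower.step l hl G εG hG F εF hF Φ hΦ⟩

theorem IsOrderedMinGens.isConeStepB_X_pow (ht : 0 < t) (hJ : IsMultigraded J)
    (h : IsOrderedMinGens (primeIdeal J) f d j) {T : ℕ} (hT : t = T) :
    IsConeStepB (𝕜 := 𝕜) (n := n) (PolyB 𝕜 n ⧸ (compA J (T - 1)).map C)
      (PolyB 𝕜 n ⧸ partialIdeal f j m) (RingS 𝔞 t ⧸ J) T (X ^ T) := by
  rw [h.partialIdeal_card]
  exact ZStable.isConeStepB_X_pow ht hJ hT

theorem IsOrderedMinGens.partialIdeal_le_preimage (hJ : IsMultigraded J)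
    (h : IsOrderedMinGens (primeIdeal J) f d j) : partialIdeal f j m ≤ preimage J := by
  rw [h.partialIdeal_card]
  exact fun p hp => (mem_preimage_iff hJ).mpr fun i _ => hp i

theorem IsOrderedMinGens.exists_isIteratedCone (ht : 0 < t) (hJ : IsZStable J)
    (h : IsOrderedMinGens (primeIdeal J) f d j) :
    ∃ (H : GradedFreeComplex (gradingB 𝕜 n)) (ε : H.ι 0 → RingS 𝔞 t ⧸ J),
      IsIteratedCone J f d j H ε := by
  obtain ⟨G, εG, hG⟩ := h.exists_coneTower ht hJ (numZero_le j) le_rfl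
  let ψ : (PolyB 𝕜 n ⧸ partialIdeal f j m) →ₐ[PolyB 𝕜 n] RingS 𝔞 t ⧸ J :=
    Ideal.Quotient.liftₐ _ (Algebra.ofId _ _) fun a ha =>
      show a ∈ RingHom.ker (algebraMap (PolyB 𝕜 n) (RingS 𝔞 t ⧸ J)) from
        (ker_algebraMap_quotient J).symm ▸ h.partialIdeal_le_preimage hJ.multigraded ha
  by_cases hT : t = ⊤
  · exact ⟨_, _, IsIteratedCone.infinite hT G εG hG ψ⟩
  · obtain ⟨T, hT⟩ := ENat.ne_top_iff_exists.mp hT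
    obtain ⟨F, εF, Φ, hF, hΦ⟩ := (h.isConeStepB_X_pow ht hJ.multigraded hT.symm).exists_comparison
      (h.coneTower_isMinResB ht hJ hG)
    exact ⟨_, _, IsIteratedCone.finite T hT.symm G εG hG ψ F εF hF Φ hΦ⟩

theorem IsOrderedMinGens.isIteratedCone_isMinResB (ht : 0 < t) (hJ : IsZStable J)
    (h : IsOrderedMinGens (primeIdeal J) f d j) {H : GradedFreeComplex (gradingB 𝕜 n)}
    {ε : H.ι 0 → RingS 𝔞 t ⧸ J} (hH : IsIteratedCone J f d j H ε) :
    IsMinResB (𝕜 := 𝕜) (n := n) (RingS 𝔞 t ⧸ J) 0 H ε := by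
  cases hH with
  | infinite hT G εG hG ψ =>
    refine (h.coneTower_isMinResB ht hJ hG).of_ker_eq (algebraMap_quotient_surjective J) ?_ ψ
    rw [ker_algebraMap_quotient, h.partialIdeal_card, primeIdeal_eq_preimage hJ.multigraded hT]
  | finite T hT G εG hG ψ F εF hF Φ hΦ =>
    exact (h.isConeStepB_X_pow ht hJ.multigraded hT).cone_isMinResB hF
      (h.coneTower_isMinResB ht hJ hG) hΦ (quotient_algHom_eq ψ)

end Generators

end Stable

end Ideals

end ZStable

theorem mainTheorem7 {𝕜 : Type*} [Field 𝕜] (n : ℕ) (𝔞 : Ideal (PolyA 𝕜 n))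
    (h𝔞 : IsHomogeneousIdeal 𝔞) (t : ℕ∞) (ht : 0 < t)
    (J : Ideal (RingS 𝔞 t)) (hJ : IsZStable J) :
    -- ordered minimal systems of multigraded generators of `J'` exist
    (∃ (m : ℕ) (f : Fin m → PolyA 𝕜 n) (d j : Fin m → ℕ),
      IsOrderedMinGens (primeIdeal J) f d j) ∧
    ∀ (m : ℕ) (f : Fin m → PolyA 𝕜 n) (d j : Fin m → ℕ),
      IsOrderedMinGens (primeIdeal J) f d j →
      -- the start: `J_⟨0⟩B`, generated by the generators of `z`-degree zero
      partialIdeal f j (numZero j) = (compA J 0).map Polynomial.C ∧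
      (∃ (P : GradedFreeComplex (gradingA 𝕜 n)) (ε : P.ι 0 → PolyA 𝕜 n ⧸ compA J 0),
        IsMinResA (compA J 0) P ε) ∧
      (∀ (P : GradedFreeComplex (gradingA 𝕜 n)) (ε : P.ι 0 → PolyA 𝕜 n ⧸ compA J 0),
        IsMinResA (compA J 0) P ε →
        IsMinResB (PolyB 𝕜 n ⧸ (compA J 0).map Polynomial.C) 0
          (P.baseChange Polynomial.C (C_mem_gradingB 𝕜 n))
          (fun a : P.ι 0 => Ideal.quotientMap ((compA J 0).map Polynomial.C)
            Polynomial.C Ideal.le_comap_map (ε a))) ∧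
      -- adding a generator `f_l z^{j_l}` with `j_l > 0`
      (∀ l : Fin m, 0 < j l →
        (partialIdeal f j l).colon {Polynomial.C (f l) * Polynomial.X ^ j l} =
          (maxA 𝕜 n).map Polynomial.C ∧
        IsConeStepB (𝕜 := 𝕜) (n := n) (ModMaxA 𝕜 n) (PolyB 𝕜 n ⧸ partialIdeal f j l)
          (PolyB 𝕜 n ⧸ partialIdeal f j (l + 1)) (d l + j l)
          (Polynomial.C (f l) * Polynomial.X ^ j l)) ∧
      -- all generators together generate `J'`, which is the preimage of `J` if `t` is infinite
      partialIdeal f j m = primeIdeal J ∧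
      (t = ⊤ → primeIdeal J = preimage J) ∧
      -- the final step if `t` is finite
      (∀ T : ℕ, t = T →
        preimage J = primeIdeal J ⊔ Ideal.span {Polynomial.X ^ T} ∧
        (primeIdeal J).colon {(Polynomial.X ^ T : PolyB 𝕜 n)} =
          (compA J (T - 1)).map Polynomial.C ∧
        IsConeStepB (𝕜 := 𝕜) (n := n) (PolyB 𝕜 n ⧸ (compA J (T - 1)).map Polynomial.C)
          (PolyB 𝕜 n ⧸ primeIdeal J) (RingS 𝔞 t ⧸ J) T (Polynomial.X ^ T)) ∧
      -- every stage of the iteration is a minimal graded free resolution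
      (∀ (s : ℕ) (G : GradedFreeComplex (gradingB 𝕜 n))
        (ε : G.ι 0 → PolyB 𝕜 n ⧸ partialIdeal f j s), ConeTower (compA J 0) f d j s G ε →
        IsMinResB (PolyB 𝕜 n ⧸ partialIdeal f j s) 0 G ε) ∧
      -- the iterated mapping cone exists, and it is a minimal graded `B`-free resolution of `S/J`
      (∃ (H : GradedFreeComplex (gradingB 𝕜 n)) (ε : H.ι 0 → RingS 𝔞 t ⧸ J),
        IsIteratedCone J f d j H ε) ∧
      (∀ (H : GradedFreeComplex (gradingB 𝕜 n)) (ε : H.ι 0 → RingS 𝔞 t ⧸ J),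
        IsIteratedCone J f d j H ε → IsMinResB (𝕜 := 𝕜) (n := n) (RingS 𝔞 t ⧸ J) 0 H ε) := by
  refine ⟨exists_isOrderedMinGens ht hJ.multigraded, fun m f d j h =>
    ⟨h.partialIdeal_numZero, exists_isMinResA (isProjClosed_compA ht hJ.multigraded 0),
      fun P ε hP => hP.baseChange rfl Ideal.le_comap_map,
      fun l hl => ⟨h.colon_eq ht hJ hl, h.isConeStepB ht hJ hl⟩, h.partialIdeal_card,
      primeIdeal_eq_preimage hJ.multigraded, fun T hT => ⟨preimage_eq_sup hJ.multigraded hT,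
        primeIdeal_colon_X_pow hT ?_, isConeStepB_X_pow ht hJ.multigraded hT⟩,
      fun s G ε hG => h.coneTower_isMinResB ht hJ hG, h.exists_isIteratedCone ht hJ,
      fun H ε hH => h.isIteratedCone_isMinResB ht hJ hH⟩⟩
  rw [hT] at ht
  exact_mod_cast ht
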